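/- Let $1<m<2$, $\kappa\in\mathbb{R}$, and put $G_m(x)=\kappa|x|^{m-2}$ for $x\in\mathbb{R}^2\setminus\{0\}$ (for a suitable $\kappa=\kappa(m)$ this is the Green function of $(-\Delta)^{m/2}$ on $\mathbb{R}^2$) and $k_m=\nabla^\perp G_m=(-\partial_{x_2}G_m,\partial_{x_1}G_m)$. Let $\rho\in C^\infty_c(\mathbb{R}^2)$ satisfy $\rho(-x)=\rho(x)$, $0\le\rho\le1$ and $\int\rho\,dx=1$; for $\epsilon>0$ let $\rho_\epsilon(x)=\epsilon^{-2}\rho(x/\epsilon)$ and $k_m^\epsilon=\rho_\epsilon\star k_m$. Given a finite signed measure $\theta_0$ on $\mathbb{R}^2$, a solution on $[0,\infty)$, in the sense of distributions, of $$\partial_t\theta+\operatorname{div}(u\theta)=0,\qquad u=k_m^\epsilon\star\theta,\qquad \theta(0)=\theta_0,$$ is a family $(\theta(t))_{t\ge0}$ of finite signed measures on $\mathbb{R}^2$, with total variation bounded on bounded time intervals, such that for all $\varphi\in C^\infty_c(\mathbb{R}^2)$ and $t\ge0$ the function $s\mapsto\int u(s,x)\cdot\nabla\varphi(x)\,\theta(s,dx)$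 is integrable on $[0,t]$ and $$\int\varphi\,d\theta(t)-\int\varphi\,d\theta_0=\int_0^t\int u(s,x)\cdot\nabla\varphi(x)\,\theta(s,dx)\,ds .$$ For finite non-negative measures $\mu,\nu$ of equal mass let $W_1(\mu,\nu)$ be the infimum of $\int \min(1,|x-y|)\,\pi(dx,dy)$ over all couplings $\pi$ of $\mu$ and $\nu$, and for finite signed measures with equal positive masses and equal negative masses let $W_1(\mu,\nu)=W_1(\mu_+,\nu_+)+W_1(\mu_-,\nu_-)$. Then the following hold. (i) For every finite signed measure $\theta_0$ and every $\epsilon>0$ there is exactly one solution $\theta$ on $[0,\infty)$. (ii) The number $c_\epsilon=\max\bigl(2\|k_m^\epsilon\|_{L^\infty},\|\nabla k_m^\epsilon\|_{L^\infty}\bigr)$ is finite. If $\theta_0^1,\theta_0^2$ are finite signed measures with the same positive mass and the same negative mass, and with total variation at most $M$, and $\theta_1,\theta_2$ are the solutions with these initial conditions, then for all $T>0$ $$\sup_{t\in[0,T]}W_1(\theta_1(t),\theta_2(t))\le C(c_\epsilon,T,M)\,W_1(\theta_0^1,\theta_0^2),$$ where $C(c_\epsilon,T,M)$ depends only on $c_\epsilon$,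 $T$ and $M$. (iii) If $\theta_0$ has a density in $L^1(\mathbb{R}^2)\cap L^\infty(\mathbb{R}^2)$, then so does $\theta(t)$ for every $t\ge0$, and $\|\theta(t)\|_{L^p}\le\|\theta_0\|_{L^p}$ for every $p\in(0,\infty]$ (in particular for $1\le p\le\infty$; for $p<1$ the two sides may be infinite). -/

import Mathlib

open MeasureTheory
open scoped NNReal ENNReal

noncomputable section

namespace GSQG

/-- The plane with its Euclidean norm. -/
abbrev Plane : Type := EuclideanSpace ℝ (Fin 2)

/-- The perpendicular gradient `(-∂₂ f, ∂₁ f)`. -/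
def perpGrad (f : Plane → ℝ) (x : Plane) : Plane :=
  !₂[-(fderiv ℝ f x (EuclideanSpace.single 1 1)), fderiv ℝ f x (EuclideanSpace.single 0 1)]

/-- The Green function of the fractional Laplacian of order `m`, up to the normalization, which is
the free parameter `κ`. -/
def green (m κ : ℝ) (x : Plane) : ℝ := κ * ‖x‖ ^ (m - 2)

/-- The kernel `k_m`, the perpendicular gradient of the Green function. -/
def kernel (m κ : ℝ) : Plane → Plane := perpGrad (green m κ)

/-- The functions `ρ` that generate the regularization. -/
structure IsMollifier (ρ : Plane → ℝ) : Prop where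
  smooth : ContDiff ℝ ((⊤ : ℕ∞) : WithTop ℕ∞) ρ
  compactSupport : HasCompactSupport ρ
  symmetric : ∀ x, ρ (-x) = ρ x
  nonneg : ∀ x, 0 ≤ ρ x
  le_one : ∀ x, ρ x ≤ 1
  integral_eq_one : ∫ x, ρ x = 1

/-- `ρ_ε (x) = ε⁻² ρ (x / ε)`. -/
def rescale (ρ : Plane → ℝ) (ε : ℝ) (x : Plane) : ℝ := (ε ^ 2)⁻¹ * ρ (ε⁻¹ • x)

/-- The regularized kernel `ρ_ε ⋆ k_m`. -/
def regKernel (m κ : ℝ) (ρ : Plane → ℝ) (ε : ℝ) : Plane → Plane :=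
  convolution (rescale ρ ε) (kernel m κ) (ContinuousLinearMap.lsmul ℝ ℝ) volume

/-- The number `max (2 ‖k‖_∞) ‖∇k‖_∞`, with the operator norm on the derivative. -/
def kernelConst (k : Plane → Plane) : ℝ≥0∞ :=
  max (2 * eLpNorm k ⊤ volume) (eLpNorm (fderiv ℝ k) ⊤ volume)

/-- The integral of a function against a finite signed measure. -/
def sintegral {F : Type*} [NormedAddCommGroup F] [NormedSpace ℝ F]
    (μ : SignedMeasure Plane) (f : Plane → F) : F :=
  (∫ x, f x ∂μ.toJordanDecomposition.posPart) - ∫ x, f x ∂μ.toJordanDecomposition.negPart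

/-- The velocity field `k ⋆ μ`. -/
def velocity (k : Plane → Plane) (μ : SignedMeasure Plane) (x : Plane) : Plane :=
  sintegral μ fun y => k (x - y)

/-- `θ` is a solution on `[0, ∞)`, in the sense of distributions, of
`∂_t θ + div (u θ) = 0`, `u = k ⋆ θ`, `θ(0) = θ₀`: a family of finite signed measures, of total
variation bounded on bounded time intervals, that satisfies the equation integrated in time against
every test function. Values at negative times are irrelevant. -/
structure IsSolution (k : Plane → Plane) (θ₀ : SignedMeasure Plane)
    (θ : ℝ → SignedMeasure Plane) : Prop where
  locally_bounded : ∀ T : ℝ, ∃ M : ℝ≥0, ∀ t ∈ Set.Icc 0 T, (θ t).totalVariation Set.univ ≤ M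
  integrable : ∀ φ : Plane → ℝ, ContDiff ℝ ((⊤ : ℕ∞) : WithTop ℕ∞) φ → HasCompactSupport φ →
    ∀ t : ℝ, 0 ≤ t → IntervalIntegrable
      (fun s => sintegral (θ s) fun x => fderiv ℝ φ x (velocity k (θ s) x)) volume 0 t
  weak_eq : ∀ φ : Plane → ℝ, ContDiff ℝ ((⊤ : ℕ∞) : WithTop ℕ∞) φ → HasCompactSupport φ →
    ∀ t : ℝ, 0 ≤ t → sintegral (θ t) φ - sintegral θ₀ φ
      = ∫ s in (0 : ℝ)..t, sintegral (θ s) fun x => fderiv ℝ φ x (velocity k (θ s) x)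

/-- The `1`-Wasserstein distance of two measures for the bounded metric `min 1 |x - y|`; it is
infinite if there is no coupling, that is, if the masses differ. -/
def wass (μ ν : Measure Plane) : ℝ≥0∞ :=
  ⨅ (π : Measure (Plane × Plane)) (_ : π.map Prod.fst = μ ∧ π.map Prod.snd = ν),
    ∫⁻ z, ENNReal.ofReal (min 1 ‖z.1 - z.2‖) ∂π

/-- The extension of the Wasserstein distance to signed measures. -/
def signedWass (μ ν : SignedMeasure Plane) : ℝ≥0∞ :=
  wass μ.toJordanDecomposition.posPart ν.toJordanDecomposition.posPart
    + wass μ.toJordanDecomposition.negPart ν.toJordanDecomposition.negPart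

end GSQG

end

/-! The singularity of `kernel` is of order $|x|^{m-3}$, which is locally integrable in the plane
because $m>1$, and the kernel is bounded away from the origin. Convolution with a test function
therefore yields a smooth kernel all of whose derivatives are bounded (`smoothBdd_regKernel`), and
its divergence vanishes since it mollifies a perpendicular gradient (`ptrace_fderiv_regKernel`).
Nothing else about the kernel is used.

The central fact is that every weak solution is transported by the flow of its own velocity field
(`IsSolution.exists_flow`). That field is smooth in space because the kernel is, and Lipschitz in
time because the equation can be tested with $y\mapsto k(x-y)$. For such a field both the flow and
any solution of the linear continuity equation are limits of the same explicit Euler scheme: one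
step has error $O(h^2)$, for trajectories as well as for the solution tested against a function with
Lipschitz gradient, so $N$ steps of length $t/N$ have error $O(1/N)$ (`IsFlow.tendsto_euler`,
`IsLinearSolution.eq_push`). No differentiability of the flow in its initial point is needed.

The rest follows from this representation. Flow maps are injective, so they transport the positive
and negative parts separately. A pair of couplings of the initial parts is carried along by the two
flows, and a Grönwall argument for the integrated bounded distance gives stability
(`exists_push_bdist_le`); the diagonal coupling gives uniqueness. An Euler step of a divergence free
field has Jacobian $1+O(h^2)$, so in the limit the flow preserves Lebesgue measure, and with it all
Lebesgue norms of a density. Existence comes from Picard–Lindelöf for the displacement of all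
particles at once, in the Banach space of bounded continuous functions (`exists_displacement`). -/

noncomputable section

namespace GSQG

open Filter Topology Set
open scoped ContDiff BoundedContinuousFunction

/-! ### Signed measures: separation by test functions, and images under injective maps -/

section SignedMeasure

/-- Smooth compactly supported functions separate finite measures on the plane. -/
theorem measure_ext_of_contDiff {μ ν : Measure Plane} [IsFiniteMeasure μ] [IsFiniteMeasure ν]
    (h : ∀ φ : Plane → ℝ, ContDiff ℝ ∞ φ → HasCompactSupport φ → ∫ x, φ x ∂μ = ∫ x, φ x ∂ν) :
    μ = ν := by
  have key : ∀ U : Set Plane, IsOpen U → μ U = ν U := by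
    intro U hU
    obtain ⟨f, hfs, hf, hf0⟩ := hU.exists_contDiff_support_eq (n := ⊤)
    let χ : ℕ → ContDiffBump (0 : Plane) := fun n => ⟨n + 1, n + 2, by positivity, by linarith⟩
    let ψ : ℕ → Plane → ℝ := fun n x => Real.smoothTransition (n * f x) * χ n x
    -- An open set is the support of a smooth $f\ge0$. The `ψ n` are test functions with values in
    -- $[0,1]$ that are eventually $1$ at each point of `U` and vanish off it.
    have hψ : ∀ n, ContDiff ℝ ∞ (ψ n) := fun n =>
      (Real.smoothTransition.contDiff.comp (contDiff_const.mul hf)).mul (χ n).contDiff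
    have hψc : ∀ n, HasCompactSupport (ψ n) := fun n => (χ n).hasCompactSupport.mul_left
    have hψ1 : ∀ n x, ‖ψ n x‖ ≤ 1 := by
      intro n x
      rw [Real.norm_eq_abs, abs_of_nonneg (mul_nonneg (Real.smoothTransition.nonneg _) (χ n).nonneg)]
      exact mul_le_one₀ (Real.smoothTransition.le_one _) (χ n).nonneg (χ n).le_one
    have hlim : ∀ x, Tendsto (fun n => ψ n x) atTop (𝓝 (U.indicator (fun _ => (1 : ℝ)) x)) := by
      intro x
      by_cases hx : x ∈ U
      · have hfx : 0 < f x := lt_of_le_of_ne (hf0 (mem_range_self x)).1 (Ne.symm (by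
          have : x ∈ Function.support f := by rw [hfs]; exact hx
          exact this))
        rw [indicator_of_mem hx]
        obtain ⟨N, hN⟩ := exists_nat_ge (max (1 / f x) ‖x‖)
        refine tendsto_const_nhds.congr' ?_
        filter_upwards [eventually_ge_atTop N] with n hn
        have hn' : (N : ℝ) ≤ n := by exact_mod_cast hn
        have h1 : 1 ≤ n * f x := by
          have := (le_max_left _ _).trans (hN.trans hn')
          rwa [div_le_iff₀ hfx] at this
        have h2 : χ n x = 1 := by
          apply (χ n).one_of_mem_closedBall
          rw [mem_closedBall_zero_iff]
          have := (le_max_right (1 / f x) _).trans (hN.trans hn')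
          change ‖x‖ ≤ (n : ℝ) + 1
          linarith
        simp [ψ, h2, Real.smoothTransition.one_of_one_le h1]
      · have hfx : f x = 0 := by
          have : x ∉ Function.support f := by rwa [hfs]
          simpa using this
        rw [indicator_of_notMem hx]
        simp [ψ, hfx]
    have hint : ∀ (ξ : Measure Plane) [IsFiniteMeasure ξ],
        Tendsto (fun n => ∫ x, ψ n x ∂ξ) atTop (𝓝 (ξ.real U)) := by
      intro ξ _
      have := tendsto_integral_of_dominated_convergence (μ := ξ) (F := ψ)
        (f := U.indicator (fun _ => (1 : ℝ))) (fun _ => 1)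
        (fun n => (hψ n).continuous.aestronglyMeasurable) (integrable_const _)
        (fun n => Eventually.of_forall (hψ1 n)) (Eventually.of_forall hlim)
      rwa [integral_indicator_const _ hU.measurableSet, smul_eq_mul, mul_one] at this
    have := tendsto_nhds_unique (hint μ) ((hint ν).congr fun n => (h _ (hψ n) (hψc n)).symm)
    exact (measureReal_eq_measureReal_iff).1 this
  refine ext_of_generate_finite _ (BorelSpace.measurable_eq (α := Plane)) isPiSystem_isOpen
    (fun s hs => key s hs) (key _ isOpen_univ)

variable {F : Type*} [NormedAddCommGroup F]

instance isFiniteMeasure_totalVariation (μ : SignedMeasure Plane) :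
    IsFiniteMeasure μ.totalVariation := by
  unfold SignedMeasure.totalVariation
  infer_instance

theorem integrable_totalVariation_iff {μ : SignedMeasure Plane} {f : Plane → F} :
    Integrable f μ.totalVariation ↔ Integrable f μ.toJordanDecomposition.posPart ∧
      Integrable f μ.toJordanDecomposition.negPart :=
  integrable_add_measure

theorem integrable_of_continuous_bounded {α : Type*} [TopologicalSpace α] [MeasurableSpace α]
    [OpensMeasurableSpace α] [SecondCountableTopology α]
    {μ : Measure α} [IsFiniteMeasure μ] {f : α → F}
    (hf : Continuous f) {C : ℝ} (hC : ∀ x, ‖f x‖ ≤ C) : Integrable f μ :=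
  Integrable.of_bound hf.aestronglyMeasurable C (Eventually.of_forall hC)

variable [NormedSpace ℝ F]

theorem sintegral_sub {μ : SignedMeasure Plane} {f g : Plane → F}
    (hf : Integrable f μ.totalVariation) (hg : Integrable g μ.totalVariation) :
    sintegral μ (fun x => f x - g x) = sintegral μ f - sintegral μ g := by
  rw [integrable_totalVariation_iff] at hf hg
  simp only [sintegral]
  rw [integral_sub hf.1 hg.1, integral_sub hf.2 hg.2]
  abel

theorem sintegral_smul (μ : SignedMeasure Plane) (c : ℝ) (f : Plane → F) :
    sintegral μ (fun x => c • f x) = c • sintegral μ f := by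
  simp only [sintegral, integral_smul, smul_sub]

theorem norm_sintegral_le {μ : SignedMeasure Plane} {f : Plane → F} {C M : ℝ} (hC0 : 0 ≤ C)
    (hC : ∀ x, ‖f x‖ ≤ C) (hM : μ.totalVariation.real univ ≤ M) :
    ‖sintegral μ f‖ ≤ C * M := by
  have h1 : μ.totalVariation.real univ = μ.toJordanDecomposition.posPart.real univ
      + μ.toJordanDecomposition.negPart.real univ := by
    unfold SignedMeasure.totalVariation
    exact measureReal_add_apply
  calc ‖sintegral μ f‖ ≤ _ := norm_sub_le _ _
    _ ≤ C * μ.toJordanDecomposition.posPart.real univ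
        + C * μ.toJordanDecomposition.negPart.real univ :=
      add_le_add (norm_integral_le_of_norm_le_const (Eventually.of_forall hC))
        (norm_integral_le_of_norm_le_const (Eventually.of_forall hC))
    _ = C * μ.totalVariation.real univ := by rw [h1]; ring
    _ ≤ C * M := mul_le_mul_of_nonneg_left hM hC0

/-- Moving the negative parts to the other side leaves an identity between positive measures, so the
two Jordan decompositions need not be compared. -/
theorem signedMeasure_ext_of_contDiff {μ ν : SignedMeasure Plane}
    (h : ∀ φ : Plane → ℝ, ContDiff ℝ ∞ φ → HasCompactSupport φ →
      sintegral μ φ = sintegral ν φ) : μ = ν := by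
  have key : μ.toJordanDecomposition.posPart + ν.toJordanDecomposition.negPart
      = ν.toJordanDecomposition.posPart + μ.toJordanDecomposition.negPart := by
    apply measure_ext_of_contDiff
    intro φ hφ hc
    obtain ⟨C, hC⟩ := hc.exists_bound_of_continuous hφ.continuous
    have hi : ∀ (ξ : Measure Plane) [IsFiniteMeasure ξ], Integrable φ ξ := fun ξ _ =>
      integrable_of_continuous_bounded hφ.continuous hC
    rw [integral_add_measure (hi _) (hi _), integral_add_measure (hi _) (hi _)]
    have := h φ hφ hc
    simp only [sintegral] at this
    linarith
  apply VectorMeasure.ext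
  intro s hs
  rw [SignedMeasure.apply_eq_posPart_real_sub_negPart_real _ hs,
    SignedMeasure.apply_eq_posPart_real_sub_negPart_real _ hs]
  have h3 := congrArg (fun m : Measure Plane => m.real s) key
  rw [measureReal_add_apply, measureReal_add_apply] at h3
  linarith

/-- The image of a signed measure on the plane under a map. -/
def push (Φ : Plane → Plane) (μ : SignedMeasure Plane) : SignedMeasure Plane :=
  VectorMeasure.map μ Φ

/-- Injectivity keeps the images of the two parts mutually singular, so no mass cancels. This is why
the signed Wasserstein distance, defined part by part, can be followed along a flow. -/
theorem toJordanDecomposition_push {Φ : Plane → Plane} (hΦ : MeasurableEmbedding Φ)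
    (μ : SignedMeasure Plane) :
    (push Φ μ).toJordanDecomposition.posPart
        = μ.toJordanDecomposition.posPart.map Φ ∧
      (push Φ μ).toJordanDecomposition.negPart
        = μ.toJordanDecomposition.negPart.map Φ := by
  let j : JordanDecomposition Plane :=
    { posPart := μ.toJordanDecomposition.posPart.map Φ
      negPart := μ.toJordanDecomposition.negPart.map Φ
      posPart_finite := inferInstance
      negPart_finite := inferInstance
      mutuallySingular := hΦ.mutuallySingular_map μ.toJordanDecomposition.mutuallySingular }
  have hj : (push Φ μ).toJordanDecomposition = j := by
    apply SignedMeasure.toJordanDecomposition_eq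
    apply VectorMeasure.ext
    intro s hs
    rw [push, VectorMeasure.map_apply _ hΦ.measurable hs,
      SignedMeasure.apply_eq_posPart_real_sub_negPart_real _ (hΦ.measurable hs),
      JordanDecomposition.toSignedMeasure, Measure.toSignedMeasure_sub_apply hs]
    simp only [j]
    rw [map_measureReal_apply hΦ.measurable hs, map_measureReal_apply hΦ.measurable hs]
  rw [hj]
  exact ⟨rfl, rfl⟩

theorem sintegral_push {Φ : Plane → Plane} (hΦ : MeasurableEmbedding Φ)
    (μ : SignedMeasure Plane) (f : Plane → F) :
    sintegral (push Φ μ) f = sintegral μ (fun x => f (Φ x)) := by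
  simp only [sintegral]
  rw [(toJordanDecomposition_push hΦ μ).1, (toJordanDecomposition_push hΦ μ).2,
    hΦ.integral_map, hΦ.integral_map]

theorem totalVariation_push_univ {Φ : Plane → Plane} (hΦ : MeasurableEmbedding Φ)
    (μ : SignedMeasure Plane) :
    (push Φ μ).totalVariation univ = μ.totalVariation univ := by
  simp only [SignedMeasure.totalVariation]
  rw [(toJordanDecomposition_push hΦ μ).1, (toJordanDecomposition_push hΦ μ).2]
  simp [Measure.map_apply hΦ.measurable MeasurableSet.univ]

end SignedMeasure

/-! ### Global integral curves -/

section ODE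

variable {E : Type*} [NormedAddCommGroup E] [NormedSpace ℝ E] [CompleteSpace E]

/-- A bounded vector field that is continuous in time and Lipschitz in space has global integral
curves. -/
theorem exists_global_integralCurve {v : ℝ → E → E} {B K : ℝ≥0} (hB : ∀ t x, ‖v t x‖ ≤ B)
    (hK : ∀ t, LipschitzWith K (v t)) (hc : ∀ x, Continuous fun t => v t x) (x₀ : E) :
    ∃ α : ℝ → E, α 0 = x₀ ∧ ∀ t, HasDerivAt α (v t (α t)) t := by
  have hloc : ∀ n : ℕ, ∃ α : ℝ → E, α 0 = x₀ ∧
      ∀ t ∈ Ioo (-(n + 1 : ℝ)) (n + 1), HasDerivAt α (v t (α t)) t := by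
    intro n
    have h0 : (0 : ℝ) ∈ Icc (-(n + 1 : ℝ)) (n + 1) := ⟨by linarith [n.cast_nonneg (α := ℝ)],
      by positivity⟩
    -- A curve with speed at most `B` stays in the ball of radius $B(n+1)$ up to time $n+1$; hence
    -- the Lipschitz constant puts no limit on the time interval.
    have hPL : IsPicardLindelof v (⟨0, h0⟩ : Icc (-(n + 1 : ℝ)) (n + 1)) x₀ (B * (n + 1)) 0 B K :=
      { lipschitzOnWith := fun t _ => (hK t).lipschitzOnWith
        continuousOn := fun x _ => (hc x).continuousOn
        norm_le := fun t _ x _ => hB t x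
        mul_max_le := by simp }
    obtain ⟨α, hα0, hα⟩ := hPL.exists_eq_forall_mem_Icc_hasDerivWithinAt₀
    exact ⟨α, hα0, fun t ht => (hα t (Ioo_subset_Icc_self ht)).hasDerivAt (Icc_mem_nhds ht.1 ht.2)⟩
  choose α hα0 hα using hloc
  have hmem : ∀ n : ℕ, (0 : ℝ) ∈ Ioo (-(n + 1 : ℝ)) (n + 1) := fun n =>
    ⟨by linarith [n.cast_nonneg (α := ℝ)], by positivity⟩
  have hmono : ∀ {n m : ℕ}, n ≤ m → Ioo (-(n + 1 : ℝ)) (n + 1) ⊆ Ioo (-(m + 1 : ℝ)) (m + 1) := by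
    intro n m hnm
    have : (n : ℝ) ≤ m := by exact_mod_cast hnm
    exact Ioo_subset_Ioo (by linarith) (by linarith)
  have heq : ∀ {n m : ℕ}, n ≤ m → EqOn (α n) (α m) (Ioo (-(n + 1 : ℝ)) (n + 1)) := by
    intro n m hnm
    exact ODE_solution_unique_of_mem_Ioo (s := fun _ => univ)
      (fun t _ => (hK t).lipschitzOnWith) (hmem n) (fun t ht => ⟨hα n t ht, trivial⟩)
      (fun t ht => ⟨hα m t (hmono hnm ht), trivial⟩) ((hα0 n).trans (hα0 m).symm)
  have hceil : ∀ t : ℝ, t ∈ Ioo (-(⌈|t|⌉₊ + 1 : ℝ)) (⌈|t|⌉₊ + 1) := by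
    intro t
    have := Nat.le_ceil |t|
    have h2 := abs_le.1 this
    exact ⟨by linarith, by linarith⟩
  -- By uniqueness the local curves agree on common intervals; the curve at time `t` is read off
  -- from one whose interval contains `t` in its interior.
  refine ⟨fun t => α ⌈|t|⌉₊ t, hα0 _, fun t => ?_⟩
  have hagree : ∀ {n : ℕ} {s : ℝ}, s ∈ Ioo (-(n + 1 : ℝ)) (n + 1) → α ⌈|s|⌉₊ s = α n s := by
    intro n s hs
    rcases le_total ⌈|s|⌉₊ n with h | h
    · exact heq h (hceil s)
    · exact (heq h hs).symm
  refine (hα _ t (hceil t)).congr_of_eventuallyEq ?_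
  filter_upwards [Ioo_mem_nhds (hceil t).1 (hceil t).2] with s hs using hagree hs

end ODE

/-! ### The flow of a regular field and its Euler approximation -/

section Flow

/-- A time-dependent vector field on the plane that is smooth in space, with a common bound `L` for
the field, its Lipschitz constants in time and space and the Lipschitz constant of its spatial
derivative. -/
structure RegField (u : ℝ → Plane → Plane) (L : ℝ≥0) : Prop where
  smooth : ∀ t, ContDiff ℝ ∞ (u t)
  bound : ∀ t x, ‖u t x‖ ≤ L
  fderiv_bound : ∀ t x, ‖fderiv ℝ (u t) x‖ ≤ L
  fderiv_lip : ∀ t x y, ‖fderiv ℝ (u t) x - fderiv ℝ (u t) y‖ ≤ L * ‖x - y‖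
  time_lip : ∀ s t x, ‖u s x - u t x‖ ≤ L * |s - t|

/-- `X` is the flow of `u`. -/
structure IsFlow (u : ℝ → Plane → Plane) (X : ℝ → Plane → Plane) : Prop where
  zero : ∀ x, X 0 x = x
  deriv : ∀ t x, HasDerivAt (fun s => X s x) (u t (X t x)) t

/-- The maps of the explicit Euler scheme with step `h`. -/
def euler (u : ℝ → Plane → Plane) (h : ℝ) : ℕ → Plane → Plane
  | 0 => fun x => x
  | n + 1 => fun x => euler u h n x + h • u (n * h) (euler u h n x)

variable {u : ℝ → Plane → Plane} {L : ℝ≥0} {X : ℝ → Plane → Plane}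

theorem RegField.lipschitz (hu : RegField u L) (t : ℝ) : LipschitzWith L (u t) :=
  lipschitzWith_of_nnnorm_fderiv_le ((hu.smooth t).differentiable (by simp))
    fun x => hu.fderiv_bound t x

theorem RegField.norm_sub_le (hu : RegField u L) (t : ℝ) (x y : Plane) :
    ‖u t x - u t y‖ ≤ L * ‖x - y‖ := by
  simpa [dist_eq_norm] using (hu.lipschitz t).dist_le_mul x y

theorem RegField.continuous_time (hu : RegField u L) (x : Plane) : Continuous fun t => u t x :=
  (LipschitzWith.of_dist_le_mul (K := L) fun s t => by
    simpa [dist_eq_norm, Real.norm_eq_abs] using hu.time_lip s t x).continuous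

theorem RegField.exists_isFlow (hu : RegField u L) : ∃ X, IsFlow u X := by
  choose α h0 h1 using exists_global_integralCurve hu.bound hu.lipschitz hu.continuous_time
  exact ⟨fun t x => α x t, h0, fun t x => h1 x t⟩

theorem IsFlow.norm_sub_time_le (hX : IsFlow u X) (hu : RegField u L) (s t : ℝ) (x : Plane) :
    ‖X s x - X t x‖ ≤ L * |s - t| :=
  convex_univ.norm_image_sub_le_of_norm_hasDerivWithin_le (f := fun s => X s x)
    (fun r _ => (hX.deriv r x).hasDerivWithinAt) (fun r _ => hu.bound r _) (mem_univ t)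
    (mem_univ s)

theorem IsFlow.norm_sub_space_le (hX : IsFlow u X) (hu : RegField u L) {t : ℝ} (ht : 0 ≤ t)
    (x y : Plane) : ‖X t x - X t y‖ ≤ ‖x - y‖ * Real.exp (L * t) := by
  have := dist_le_of_trajectories_ODE (v := u) (K := L) (f := fun s => X s x)
    (g := fun s => X s y) (a := 0) (b := t) (δ := dist x y) hu.lipschitz
    (fun s _ => (hX.deriv s x).continuousAt.continuousWithinAt)
    (fun s _ => (hX.deriv s x).hasDerivWithinAt)
    (fun s _ => (hX.deriv s y).continuousAt.continuousWithinAt)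
    (fun s _ => (hX.deriv s y).hasDerivWithinAt)
    (by rw [hX.zero, hX.zero]) t ⟨ht, le_rfl⟩
  simpa [dist_eq_norm] using this

theorem IsFlow.injective (hX : IsFlow u X) (hu : RegField u L) (t : ℝ) :
    Function.Injective (X t) := by
  intro x y hxy
  have := ODE_solution_unique_univ (v := u) (s := fun _ => univ) (K := L) (f := fun s => X s x)
    (g := fun s => X s y) (t₀ := t) (fun s => (hu.lipschitz s).lipschitzOnWith)
    (fun s => ⟨hX.deriv s x, trivial⟩) (fun s => ⟨hX.deriv s y, trivial⟩) hxy
  simpa [hX.zero] using congrFun this 0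

/-- The spatial estimate is available for nonnegative times only; freezing the flow at negative
times gives a function that is jointly continuous on the whole of $\mathbb R\times\mathbb R^2$. -/
theorem IsFlow.continuous_max (hX : IsFlow u X) (hu : RegField u L) :
    Continuous fun p : ℝ × Plane => X (max p.1 0) p.2 := by
  rw [continuous_iff_continuousAt]
  rintro ⟨t, x⟩
  rw [ContinuousAt, tendsto_iff_norm_sub_tendsto_zero]
  have hb : ∀ p : ℝ × Plane, ‖X (max p.1 0) p.2 - X (max t 0) x‖
      ≤ L * |max p.1 0 - max t 0| + ‖p.2 - x‖ * Real.exp (L * max t 0) := fun p =>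
    calc ‖X (max p.1 0) p.2 - X (max t 0) x‖
        = ‖(X (max p.1 0) p.2 - X (max t 0) p.2) + (X (max t 0) p.2 - X (max t 0) x)‖ := by
          congr 1; abel
      _ ≤ _ := (norm_add_le _ _).trans (add_le_add (hX.norm_sub_time_le hu _ _ _)
          (hX.norm_sub_space_le hu (le_max_right _ _) _ _))
  refine squeeze_zero (fun _ => norm_nonneg _) hb ?_
  have hc : Continuous fun p : ℝ × Plane =>
      (L : ℝ) * |max p.1 0 - max t 0| + ‖p.2 - x‖ * Real.exp (L * max t 0) := by fun_prop
  simpa using hc.tendsto (t, x)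

theorem IsFlow.continuous_space (hX : IsFlow u X) (hu : RegField u L) {t : ℝ} (ht : 0 ≤ t) :
    Continuous (X t) := by
  simpa [Function.comp_def, max_eq_left ht] using
    (hX.continuous_max hu).comp (Continuous.prodMk_right t)

/-- By the Lusin–Souslin theorem a continuous injection of the plane is a measurable embedding, so
no inverse flow has to be constructed. -/
theorem IsFlow.measurableEmbedding (hX : IsFlow u X) (hu : RegField u L) {t : ℝ} (ht : 0 ≤ t) :
    MeasurableEmbedding (X t) :=
  (hX.continuous_space hu ht).measurableEmbedding (hX.injective hu t)

/-- During a step the velocity along a trajectory changes by at most $(L+L^2)h$: $Lh$ from the time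
dependence, and $L\cdot Lh$ from the distance travelled. -/
theorem IsFlow.local_error (hX : IsFlow u X) (hu : RegField u L) {h : ℝ} (hh : 0 ≤ h) (t : ℝ)
    (x : Plane) : ‖X (t + h) x - (X t x + h • u t (X t x))‖ ≤ (L + L * L) * h ^ 2 := by
  have key := norm_image_sub_le_of_norm_deriv_le_segment' (a := t) (b := t + h)
    (f := fun s => X s x - s • u t (X t x)) (f' := fun s => u s (X s x) - u t (X t x))
    (C := (L + L * L) * h)
    (fun s _ => by
      have h1 := (hX.deriv s x).sub ((hasDerivAt_id s).smul_const (u t (X t x)))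
      simp only [one_smul] at h1
      exact h1.hasDerivWithinAt)
    (fun s hs => by
      have h1 : |s - t| ≤ h := by rw [abs_of_nonneg (by linarith [hs.1])]; linarith [hs.2]
      calc ‖u s (X s x) - u t (X t x)‖
          = ‖(u s (X s x) - u t (X s x)) + (u t (X s x) - u t (X t x))‖ := by congr 1; abel
        _ ≤ L * |s - t| + L * (L * |s - t|) := (norm_add_le _ _).trans (add_le_add
            (hu.time_lip _ _ _) ((hu.norm_sub_le _ _ _).trans (mul_le_mul_of_nonneg_left
              (hX.norm_sub_time_le hu _ _ _) L.2)))
        _ = (L + L * L) * |s - t| := by ring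
        _ ≤ (L + L * L) * h := by gcongr)
    (t + h) ⟨by linarith, le_rfl⟩
  calc ‖X (t + h) x - (X t x + h • u t (X t x))‖
      = ‖X (t + h) x - (t + h) • u t (X t x) - (X t x - t • u t (X t x))‖ := by
        congr 1; rw [add_smul]; abel
    _ ≤ (L + L * L) * h * (t + h - t) := key
    _ = _ := by ring

/-- Each step multiplies the previous error by at most $1+hL$ and adds one local error. -/
theorem IsFlow.norm_euler_sub_le (hX : IsFlow u X) (hu : RegField u L) {h : ℝ} (hh : 0 ≤ h)
    (n : ℕ) (x : Plane) :
    ‖euler u h n x - X (n * h) x‖ ≤ n * (L + L * L) * h ^ 2 * (1 + h * L) ^ n := by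
  induction n with
  | zero => simp [euler, hX.zero]
  | succ n ih =>
    have hL : (0 : ℝ) ≤ L := L.2
    have h1 : ((n + 1 : ℕ) : ℝ) * h = n * h + h := by push_cast; ring
    rw [h1]
    have h2 : (1 : ℝ) ≤ (1 + h * L) ^ (n + 1) := one_le_pow₀ (by nlinarith [mul_nonneg hh hL])
    calc ‖euler u h (n + 1) x - X (n * h + h) x‖
        = ‖(euler u h n x - X (n * h) x)
            + h • (u (n * h) (euler u h n x) - u (n * h) (X (n * h) x))
            - (X (n * h + h) x - (X (n * h) x + h • u (n * h) (X (n * h) x)))‖ := by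
          congr 1; simp only [euler, smul_sub]; abel
      _ ≤ ‖euler u h n x - X (n * h) x‖ + h * (L * ‖euler u h n x - X (n * h) x‖)
            + (L + L * L) * h ^ 2 := by
          refine (norm_sub_le _ _).trans (add_le_add ((norm_add_le _ _).trans
            (add_le_add le_rfl ?_)) (hX.local_error hu hh _ _))
          rw [norm_smul, Real.norm_of_nonneg hh]
          exact mul_le_mul_of_nonneg_left (hu.norm_sub_le _ _ _) hh
      _ = (1 + h * L) * ‖euler u h n x - X (n * h) x‖ + (L + L * L) * h ^ 2 := by ring
      _ ≤ (1 + h * L) * (n * (L + L * L) * h ^ 2 * (1 + h * L) ^ n)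
            + (L + L * L) * h ^ 2 * (1 + h * L) ^ (n + 1) := by
          exact add_le_add (by gcongr) (le_mul_of_one_le_right (by positivity) h2)
      _ = _ := by push_cast; ring

/-- The power is at most $e^{cta}$, which leaves a factor $1/(N+1)$. The exponent `c` is $1$ for
trajectories and $2$ for test functions, whose bounds grow by $(1+hL)^2$ in each step. -/
theorem tendsto_euler_error (C a t : ℝ) (ha : 0 ≤ a) (ht : 0 ≤ t) (hC : 0 ≤ C) (c : ℕ) :
    Tendsto (fun N : ℕ => ((N + 1 : ℕ) : ℝ) * C * (t / ((N + 1 : ℕ) : ℝ)) ^ 2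
      * (1 + t / ((N + 1 : ℕ) : ℝ) * a) ^ (c * (N + 1))) atTop (𝓝 0) := by
  have h1 : Tendsto (fun N : ℕ => C * t ^ 2 * Real.exp (c * (t * a)) * (1 / ((N : ℝ) + 1)))
      atTop (𝓝 0) := by
    simpa using tendsto_one_div_add_atTop_nhds_zero_nat.const_mul
      (C * t ^ 2 * Real.exp (c * (t * a)))
  refine squeeze_zero (fun N => by positivity) (fun N => ?_) h1
  have hN : (0 : ℝ) < (N + 1 : ℕ) := by positivity
  have h2 : (1 + t / ((N + 1 : ℕ) : ℝ) * a) ^ (c * (N + 1)) ≤ Real.exp (c * (t * a)) := by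
    calc (1 + t / ((N + 1 : ℕ) : ℝ) * a) ^ (c * (N + 1))
        ≤ Real.exp (t / ((N + 1 : ℕ) : ℝ) * a) ^ (c * (N + 1)) := by
          gcongr
          linarith [Real.add_one_le_exp (t / ((N + 1 : ℕ) : ℝ) * a)]
      _ = Real.exp (c * (t * a)) := by
          rw [← Real.exp_nat_mul]
          congr 1
          push_cast at hN ⊢
          field_simp
  calc ((N + 1 : ℕ) : ℝ) * C * (t / ((N + 1 : ℕ) : ℝ)) ^ 2
      * (1 + t / ((N + 1 : ℕ) : ℝ) * a) ^ (c * (N + 1))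
      ≤ ((N + 1 : ℕ) : ℝ) * C * (t / ((N + 1 : ℕ) : ℝ)) ^ 2 * Real.exp (c * (t * a)) := by
        gcongr
    _ = _ := by
        push_cast at hN ⊢
        field_simp

theorem IsFlow.tendsto_euler (hX : IsFlow u X) (hu : RegField u L) {t : ℝ} (ht : 0 ≤ t)
    (x : Plane) :
    Tendsto (fun N : ℕ => euler u (t / ((N + 1 : ℕ) : ℝ)) (N + 1) x) atTop (𝓝 (X t x)) := by
  rw [tendsto_iff_norm_sub_tendsto_zero]
  refine squeeze_zero (fun _ => norm_nonneg _) (fun N => ?_)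
    (tendsto_euler_error (L + L * L) L t L.2 ht (by positivity) 1)
  have := hX.norm_euler_sub_le hu (h := t / ((N + 1 : ℕ) : ℝ)) (by positivity) (N + 1) x
  rw [mul_div_cancel₀ t (by positivity)] at this
  simpa using this

theorem RegField.continuous_euler (hu : RegField u L) (h : ℝ) (n : ℕ) :
    Continuous (euler u h n) := by
  induction n with
  | zero => exact continuous_id
  | succ n ih => exact ih.add (((hu.lipschitz _).continuous.comp ih).const_smul h)

theorem RegField.norm_euler_sub_self_le (hu : RegField u L) {h : ℝ} (hh : 0 ≤ h) (n : ℕ)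
    (x : Plane) : ‖euler u h n x - x‖ ≤ n * h * L := by
  induction n with
  | zero => simp [euler]
  | succ n ih =>
    calc ‖euler u h (n + 1) x - x‖ = ‖(euler u h n x - x) + h • u (n * h) (euler u h n x)‖ := by
          congr 1; simp only [euler]; abel
      _ ≤ n * h * L + h * L := by
          refine (norm_add_le _ _).trans (add_le_add ih ?_)
          rw [norm_smul, Real.norm_of_nonneg hh]
          exact mul_le_mul_of_nonneg_left (hu.bound _ _) hh
      _ = _ := by push_cast; ring

end Flow

/-! ### Flows of divergence free fields preserve Lebesgue measure -/

section Volume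

/-- The trace of an endomorphism of the plane. -/
def ptrace (A : Plane →L[ℝ] Plane) : ℝ :=
  A (EuclideanSpace.single 0 1) 0 + A (EuclideanSpace.single 1 1) 1

/-- In dimension two $\det(1+hA)=1+h\operatorname{tr}A+h^2\det A$, and $|\det A|\le 2L^2$ because
each entry is at most $L$. -/
theorem abs_det_one_add_smul_sub_one_le {A : Plane →L[ℝ] Plane} {L : ℝ} (hA : ‖A‖ ≤ L)
    (htr : ptrace A = 0) (h : ℝ) :
    |(ContinuousLinearMap.id ℝ Plane + h • A).det - 1| ≤ 2 * L ^ 2 * h ^ 2 := by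
  have hent : ∀ i j : Fin 2, |A (EuclideanSpace.single j 1) i| ≤ L := by
    intro i j
    calc |A (EuclideanSpace.single j 1) i| ≤ ‖A (EuclideanSpace.single j 1)‖ := by
          simpa using PiLp.norm_apply_le (A (EuclideanSpace.single j 1)) i
      _ ≤ ‖A‖ * ‖(EuclideanSpace.single j 1 : Plane)‖ := A.le_opNorm _
      _ ≤ L := by simpa using hA
  have hdet : (ContinuousLinearMap.id ℝ Plane + h • A).det
      = 1 + h * ptrace A + h ^ 2 * (A (EuclideanSpace.single 0 1) 0 * A (EuclideanSpace.single 1 1) 1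
        - A (EuclideanSpace.single 1 1) 0 * A (EuclideanSpace.single 0 1) 1) := by
    rw [ContinuousLinearMap.det, ← LinearMap.det_toMatrix (EuclideanSpace.basisFun (Fin 2) ℝ).toBasis,
      Matrix.det_fin_two]
    simp [LinearMap.toMatrix_apply, ptrace]
    ring
  rw [hdet, htr]
  have h1 := hent 0 0
  have h2 := hent 1 1
  have h3 := hent 0 1
  have h4 := hent 1 0
  have hL : 0 ≤ L := (norm_nonneg A).trans hA
  have e1 : |A (EuclideanSpace.single 0 1) 0 * A (EuclideanSpace.single 1 1) 1| ≤ L * L := by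
    rw [abs_mul]; exact mul_le_mul h1 h2 (abs_nonneg _) hL
  have e2 : |A (EuclideanSpace.single 1 1) 0 * A (EuclideanSpace.single 0 1) 1| ≤ L * L := by
    rw [abs_mul]; exact mul_le_mul h3 h4 (abs_nonneg _) hL
  have e3 := (abs_sub (A (EuclideanSpace.single 0 1) 0 * A (EuclideanSpace.single 1 1) 1)
    (A (EuclideanSpace.single 1 1) 0 * A (EuclideanSpace.single 0 1) 1)).trans (add_le_add e1 e2)
  rw [show ∀ z : ℝ, 1 + h * 0 + h ^ 2 * z - 1 = h ^ 2 * z by intro z; ring, abs_mul,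
    abs_of_nonneg (sq_nonneg h)]
  nlinarith [sq_nonneg h]

variable {u : ℝ → Plane → Plane} {L : ℝ≥0} {X : ℝ → Plane → Plane}

/-- A perturbation of the identity by a contraction. Injectivity permits the change of variables,
and surjectivity makes the image the whole plane. -/
theorem bijective_id_add_of_lipschitz {g : Plane → Plane} {c : ℝ≥0} (hg : LipschitzWith c g)
    (hc : c < 1) : Function.Bijective fun x => x + g x := by
  have hA : ApproximatesLinearOn (fun x => x + g x)
      ((ContinuousLinearEquiv.refl ℝ Plane : Plane ≃L[ℝ] Plane) : Plane →L[ℝ] Plane) univ c := by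
    intro x _ y _
    have := hg.dist_le_mul x y
    rw [dist_eq_norm, dist_eq_norm] at this
    have e : x + g x - (y + g y) - (x - y) = g x - g y := by abel
    change ‖x + g x - (y + g y) - (x - y)‖ ≤ _
    rwa [e]
  have hc' : Subsingleton Plane ∨
      c < ‖((ContinuousLinearEquiv.refl ℝ Plane).symm : Plane →L[ℝ] Plane)‖₊⁻¹ := by
    right
    have : ‖((ContinuousLinearEquiv.refl ℝ Plane).symm : Plane →L[ℝ] Plane)‖₊ = 1 :=
      ContinuousLinearMap.nnnorm_id
    rw [this]
    simpa using hc
  exact ⟨injOn_univ.1 (hA.injOn hc'), hA.surjective hc'⟩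

theorem RegField.lintegral_euler_step (hu : RegField u L) (hdiv : ∀ t x, ptrace (fderiv ℝ (u t) x) = 0)
    {h : ℝ} (hh : 0 ≤ h) (hL : h * L < 1) (t : ℝ) (g : Plane → ℝ≥0∞) :
    ENNReal.ofReal (1 - 2 * L ^ 2 * h ^ 2) * ∫⁻ x, g (x + h • u t x) ≤ ∫⁻ x, g x ∧
      ∫⁻ x, g x ≤ ENNReal.ofReal (1 + 2 * L ^ 2 * h ^ 2) * ∫⁻ x, g (x + h • u t x) := by
  have hlip : LipschitzWith (⟨h, hh⟩ * L) fun x => h • u t x :=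
    LipschitzWith.of_dist_le_mul fun x y => by
      rw [dist_eq_norm, ← smul_sub, norm_smul, Real.norm_of_nonneg hh, dist_eq_norm]
      exact (mul_le_mul_of_nonneg_left (hu.norm_sub_le t x y) hh).trans_eq (mul_assoc h _ _).symm
  have hbij := bijective_id_add_of_lipschitz hlip (by exact_mod_cast hL)
  have hd : ∀ x, HasFDerivAt (fun x => x + h • u t x)
      (ContinuousLinearMap.id ℝ Plane + h • fderiv ℝ (u t) x) x := fun x =>
    (hasFDerivAt_id x).add
      ((((hu.smooth t).differentiable (by simp)) x).hasFDerivAt.const_smul h)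
  have hcv := lintegral_image_eq_lintegral_abs_det_fderiv_mul volume MeasurableSet.univ
    (fun x _ => (hd x).hasFDerivWithinAt) hbij.1.injOn g
  rw [image_univ, hbij.2.range_eq, Measure.restrict_univ] at hcv
  have hdet := fun x => abs_le.1
    (abs_det_one_add_smul_sub_one_le (hu.fderiv_bound t x) (hdiv t x) h)
  rw [hcv, ← lintegral_const_mul' _ _ ENNReal.ofReal_ne_top,
    ← lintegral_const_mul' _ _ ENNReal.ofReal_ne_top]
  constructor
  · refine lintegral_mono fun x => ?_
    gcongr
    exact le_trans (by linarith [(hdet x).1]) (le_abs_self _)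
  · refine lintegral_mono fun x => ?_
    gcongr
    have : 2 * (L : ℝ) ^ 2 * h ^ 2 ≤ 1 * 2 := by
      have h1 : (h * L) ^ 2 ≤ 1 := pow_le_one₀ (mul_nonneg hh L.2) hL.le
      linarith [mul_pow h (L : ℝ) 2]
    exact abs_le.2 ⟨by linarith [(hdet x).1], by linarith [(hdet x).2]⟩

theorem RegField.lintegral_euler (hu : RegField u L) (hdiv : ∀ t x, ptrace (fderiv ℝ (u t) x) = 0)
    {h : ℝ} (hh : 0 ≤ h) (hL : h * L < 1) (n : ℕ) (g : Plane → ℝ≥0∞) :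
    ENNReal.ofReal (1 - 2 * L ^ 2 * h ^ 2) ^ n * ∫⁻ x, g (euler u h n x) ≤ ∫⁻ x, g x ∧
      ∫⁻ x, g x ≤ ENNReal.ofReal (1 + 2 * L ^ 2 * h ^ 2) ^ n * ∫⁻ x, g (euler u h n x) := by
  induction n generalizing g with
  | zero => simp [euler]
  | succ n ih =>
    -- The last Euler step is composed on the outside, so the induction hypothesis applies to `g`
    -- after that step.
    have h1 := ih fun x => g (x + h • u (n * h) x)
    have h2 := hu.lintegral_euler_step hdiv hh hL (n * h) g
    constructor
    · refine le_trans ?_ h2.1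
      rw [pow_succ' _ n, mul_assoc]
      gcongr
      exact h1.1
    · refine h2.2.trans ?_
      rw [pow_succ' _ n, mul_assoc (ENNReal.ofReal _)]
      exact mul_le_mul_right h1.2 _

/-- Along the Euler scheme the integral changes at most by the factors $(1\pm 2L^2t^2/N^2)^N\to1$.
Particles move at most $tL$, so all integrands live in one ball and dominated convergence applies.
-/
theorem IsFlow.lintegral_comp (hX : IsFlow u X) (hu : RegField u L)
    (hdiv : ∀ t x, ptrace (fderiv ℝ (u t) x) = 0) {t : ℝ} (ht : 0 ≤ t) {g : Plane → ℝ≥0}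
    (hg : Continuous g) (hgc : HasCompactSupport g) :
    ∫⁻ x, g (X t x) = ∫⁻ x, g x := by
  obtain ⟨R, hR⟩ := hgc.isCompact.isBounded.subset_closedBall 0
  obtain ⟨C, hC⟩ : ∃ C : ℝ≥0, ∀ x, g x ≤ C := by
    obtain ⟨C, hC⟩ := (hgc.comp_left (g := ((↑) : ℝ≥0 → ℝ)) rfl).exists_bound_of_continuous
      (NNReal.continuous_coe.comp hg)
    refine ⟨C.toNNReal, fun x => ?_⟩
    have := hC x
    simp only [Function.comp_apply, NNReal.norm_eq] at this
    exact NNReal.le_toNNReal_of_coe_le this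
  have hbd : ∀ (N : ℕ) (x : Plane), (g (euler u (t / ((N + 1 : ℕ) : ℝ)) (N + 1) x) : ℝ≥0∞)
      ≤ (Metric.closedBall (0 : Plane) (R + t * L)).indicator (fun _ => (C : ℝ≥0∞)) x := by
    intro N x
    by_cases hx : x ∈ Metric.closedBall (0 : Plane) (R + t * L)
    · rw [indicator_of_mem hx]
      exact_mod_cast hC _
    · have : g (euler u (t / ((N + 1 : ℕ) : ℝ)) (N + 1) x) = 0 := by
        by_contra hne
        apply hx
        have h1 := hR (subset_tsupport _ (Function.mem_support.2 hne))
        rw [mem_closedBall_zero_iff] at h1 ⊢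
        have h2 := hu.norm_euler_sub_self_le (h := t / ((N + 1 : ℕ) : ℝ)) (by positivity) (N + 1) x
        rw [mul_div_cancel₀ t (by positivity), norm_sub_rev] at h2
        linarith [norm_le_norm_add_norm_sub' x (euler u (t / ((N + 1 : ℕ) : ℝ)) (N + 1) x)]
      rw [this]
      exact zero_le
  have hbfin : ∫⁻ x, (Metric.closedBall (0 : Plane) (R + t * L)).indicator
      (fun _ => (C : ℝ≥0∞)) x ≠ ⊤ := by
    rw [lintegral_indicator_const Metric.isClosed_closedBall.measurableSet]
    exact ENNReal.mul_ne_top ENNReal.coe_ne_top measure_closedBall_lt_top.ne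
  have hlim := tendsto_lintegral_of_dominated_convergence (μ := volume)
    (F := fun N x => (g (euler u (t / ((N + 1 : ℕ) : ℝ)) (N + 1) x) : ℝ≥0∞))
    (f := fun x => (g (X t x) : ℝ≥0∞)) _
    (fun N => (ENNReal.continuous_coe.comp (hg.comp (hu.continuous_euler _ _))).measurable)
    (fun N => Eventually.of_forall (hbd N)) hbfin
    (Eventually.of_forall fun x => ((ENNReal.continuous_coe.comp hg).tendsto _).comp
      (hX.tendsto_euler hu ht x))
  have hpow : ∀ a : ℝ, Tendsto (fun N : ℕ =>
      ENNReal.ofReal (1 + a * (t / ((N + 1 : ℕ) : ℝ)) ^ 2) ^ (N + 1)) atTop (𝓝 1) := by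
    intro a
    have h1 : Tendsto (fun n : ℕ => (1 + a * (t / (n : ℝ)) ^ 2) ^ n) atTop (𝓝 1) := by
      rw [show 𝓝 (1 : ℝ) = 𝓝 (Real.exp 0) by rw [Real.exp_zero]]
      apply Real.tendsto_one_add_pow_exp_of_tendsto
      have := (tendsto_const_div_atTop_nhds_zero_nat (a * t ^ 2))
      refine this.congr' ?_
      filter_upwards [eventually_gt_atTop 0] with n hn
      have : (0 : ℝ) < n := by exact_mod_cast hn
      field_simp
    have h2 := ENNReal.tendsto_ofReal (h1.comp (tendsto_add_atTop_nat 1))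
    rw [ENNReal.ofReal_one] at h2
    have h3 : Tendsto (fun N : ℕ => 1 + a * (t / ((N + 1 : ℕ) : ℝ)) ^ 2) atTop (𝓝 1) := by
      have h4 := ((tendsto_const_div_atTop_nhds_zero_nat t).comp (tendsto_add_atTop_nat 1))
      simpa [Function.comp_def] using ((h4.pow 2).const_mul a).const_add 1
    refine h2.congr' ?_
    filter_upwards [h3.eventually (eventually_gt_nhds zero_lt_one)] with N hN
    exact ENNReal.ofReal_pow hN.le _
  have hsmall : ∀ᶠ N : ℕ in atTop, t / ((N + 1 : ℕ) : ℝ) * L < 1 := by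
    have h4 := ((tendsto_const_div_atTop_nhds_zero_nat t).comp (tendsto_add_atTop_nat 1)).mul_const
      (L : ℝ)
    rw [zero_mul] at h4
    exact h4.eventually (eventually_lt_nhds zero_lt_one)
  have hup := ENNReal.Tendsto.mul (hpow (2 * L ^ 2)) (Or.inl one_ne_zero) hlim
    (Or.inr ENNReal.one_ne_top)
  have hlo := ENNReal.Tendsto.mul (hpow (-(2 * L ^ 2))) (Or.inl one_ne_zero) hlim
    (Or.inr ENNReal.one_ne_top)
  rw [one_mul] at hup hlo
  refine le_antisymm (le_of_tendsto hlo ?_) (ge_of_tendsto hup ?_)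
  · filter_upwards [hsmall] with N hN
    have := (hu.lintegral_euler hdiv (by positivity) hN (N + 1) fun x => (g x : ℝ≥0∞)).1
    rwa [sub_eq_add_neg, ← neg_mul] at this
  · filter_upwards [hsmall] with N hN
    exact (hu.lintegral_euler hdiv (by positivity) hN (N + 1) fun x => (g x : ℝ≥0∞)).2

theorem IsFlow.measurePreserving (hX : IsFlow u X) (hu : RegField u L)
    (hdiv : ∀ t x, ptrace (fderiv ℝ (u t) x) = 0) {t : ℝ} (ht : 0 ≤ t) :
    MeasurePreserving (X t) volume volume := by
  have hXc := hX.continuous_space hu ht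
  refine ⟨hXc.measurable, ?_⟩
  -- The preimage of a ball lies in a ball whose radius is larger by $Lt$. Local finiteness is
  -- needed for the comparison of measures through compactly supported functions.
  have : IsFiniteMeasureOnCompacts (Measure.map (X t) volume) := ⟨fun K hK => by
    obtain ⟨R, hR⟩ := hK.isBounded.subset_closedBall 0
    rw [Measure.map_apply hXc.measurable hK.measurableSet]
    refine lt_of_le_of_lt (measure_mono (t := Metric.closedBall 0 (R + L * t)) ?_)
      measure_closedBall_lt_top
    intro x hx
    have h1 := hR hx
    rw [mem_closedBall_zero_iff] at h1 ⊢
    have h2 := hX.norm_sub_time_le hu 0 t x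
    rw [hX.zero, zero_sub, abs_neg, abs_of_nonneg ht] at h2
    linarith [norm_le_norm_add_norm_sub' x (X t x)]⟩
  apply Measure.ext_of_integral_eq_on_compactlySupported_nnreal
  intro f
  have hf : Continuous f := f.continuous
  have hf' : Continuous fun x => (f x : ℝ) := NNReal.continuous_coe.comp hf
  have hf'' : Continuous fun x => (f (X t x) : ℝ) := hf'.comp hXc
  rw [integral_map hXc.aemeasurable hf'.aestronglyMeasurable,
    integral_eq_lintegral_of_nonneg_ae (Eventually.of_forall fun _ => NNReal.zero_le_coe)
      hf''.aestronglyMeasurable,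
    integral_eq_lintegral_of_nonneg_ae (Eventually.of_forall fun _ => NNReal.zero_le_coe)
      hf'.aestronglyMeasurable]
  simp only [ENNReal.ofReal_coe_nnreal]
  rw [hX.lintegral_comp hu hdiv ht hf f.hasCompactSupport]

end Volume

/-! ### The regularized kernel: smoothness, bounds, zero divergence -/

section Kernel

/-- The Green function with its singularity smoothed out; the parameter `δ = 0` gives back
`green`. -/
def smoothGreen (m κ δ : ℝ) (x : Plane) : ℝ := κ * (‖x‖ ^ 2 + δ) ^ ((m - 2) / 2)

theorem smoothGreen_zero (m κ : ℝ) : smoothGreen m κ 0 = green m κ := by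
  funext x
  simp only [smoothGreen, green, add_zero]
  rw [← Real.rpow_natCast, ← Real.rpow_mul (norm_nonneg x)]
  congr 2
  push_cast
  ring

theorem hasFDerivAt_smoothGreen (m κ : ℝ) {δ : ℝ} {x : Plane} (h : ‖x‖ ^ 2 + δ ≠ 0) :
    HasFDerivAt (smoothGreen m κ δ)
      ((κ * (m - 2) * (‖x‖ ^ 2 + δ) ^ ((m - 4) / 2)) • innerSL ℝ x) x := by
  have h1 : HasFDerivAt (fun y : Plane => ‖y‖ ^ 2 + δ) (2 • innerSL ℝ x) x :=
    ((hasStrictFDerivAt_norm_sq x).hasFDerivAt).add_const δ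
  have h2 := (h1.rpow_const (p := (m - 2) / 2) (Or.inl h)).const_mul κ
  refine h2.congr_fderiv ?_
  ext v
  simp only [smul_apply, smul_eq_mul, nsmul_eq_mul]
  rw [show (m - 2) / 2 - 1 = (m - 4) / 2 by ring]
  push_cast
  ring

/-- The exponent $(m-4)/2$ is negative, so adding $\delta$ only decreases the power. The bound is
uniform in $\delta\ge0$: it controls the kernel itself at $\delta=0$ and dominates the limit
$\delta\to0$. -/
theorem abs_fderiv_smoothGreen_le {m : ℝ} (hm : m < 2) (κ : ℝ) {δ : ℝ} (hδ : 0 ≤ δ) {x : Plane}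
    (hx : x ≠ 0) (v : Plane) :
    |fderiv ℝ (smoothGreen m κ δ) x v| ≤ |κ * (m - 2)| * ‖x‖ ^ (m - 3) * ‖v‖ := by
  have hx0 : 0 < ‖x‖ := norm_pos_iff.2 hx
  have hx2 : 0 < ‖x‖ ^ 2 := by positivity
  rw [(hasFDerivAt_smoothGreen m κ (δ := δ) (by positivity)).fderiv]
  have h1 : (‖x‖ ^ 2 + δ) ^ ((m - 4) / 2) ≤ ‖x‖ ^ (m - 4) := by
    have : (‖x‖ ^ 2) ^ ((m - 4) / 2) = ‖x‖ ^ (m - 4) := by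
      rw [← Real.rpow_natCast, ← Real.rpow_mul hx0.le]
      congr 1
      push_cast
      ring
    rw [← this]
    exact Real.rpow_le_rpow_of_nonpos hx2 (by linarith) (by linarith)
  have h2 : ‖x‖ ^ (m - 3) = ‖x‖ ^ (m - 4) * ‖x‖ := by
    rw [show m - 3 = (m - 4) + 1 by ring, Real.rpow_add hx0, Real.rpow_one]
  have h3 : |inner ℝ x v| ≤ ‖x‖ * ‖v‖ := abs_real_inner_le_norm x v
  simp only [smul_apply, smul_eq_mul, innerSL_apply_apply]
  rw [abs_mul, abs_mul, abs_of_nonneg (a := (‖x‖ ^ 2 + δ) ^ ((m - 4) / 2)) (by positivity), h2]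
  calc |κ * (m - 2)| * (‖x‖ ^ 2 + δ) ^ ((m - 4) / 2) * |inner ℝ x v|
      ≤ |κ * (m - 2)| * ‖x‖ ^ (m - 4) * (‖x‖ * ‖v‖) := by gcongr
    _ = _ := by ring

theorem measurable_kernel (m κ : ℝ) : Measurable (kernel m κ) := by
  unfold kernel perpGrad
  have h0 := measurable_fderiv_apply_const ℝ (green m κ) (EuclideanSpace.single (0 : Fin 2) (1 : ℝ))
  have h1 := measurable_fderiv_apply_const ℝ (green m κ) (EuclideanSpace.single (1 : Fin 2) (1 : ℝ))
  apply (WithLp.measurable_toLp 2 (Fin 2 → ℝ)).comp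
  apply measurable_pi_lambda
  intro i
  fin_cases i
  · exact h1.neg
  · exact h0

theorem norm_kernel_le {m : ℝ} (hm : m < 2) (κ : ℝ) {x : Plane} (hx : x ≠ 0) :
    ‖kernel m κ x‖ ≤ 2 * |κ * (m - 2)| * ‖x‖ ^ (m - 3) := by
  have h : ∀ i : Fin 2, |fderiv ℝ (green m κ) x (EuclideanSpace.single i 1)|
      ≤ |κ * (m - 2)| * ‖x‖ ^ (m - 3) := by
    intro i
    have := abs_fderiv_smoothGreen_le hm κ le_rfl hx (EuclideanSpace.single i 1)
    rw [smoothGreen_zero] at this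
    simpa using this
  have h0 : 0 ≤ |κ * (m - 2)| * ‖x‖ ^ (m - 3) := (abs_nonneg _).trans (h 0)
  rw [EuclideanSpace.norm_eq]
  apply Real.sqrt_le_iff.2
  refine ⟨by linarith, ?_⟩
  simp only [Fin.sum_univ_two, kernel, perpGrad]
  simp only [Matrix.cons_val_zero, Matrix.cons_val_one, norm_neg, Real.norm_eq_abs]
  nlinarith [h 0, h 1, abs_nonneg (fderiv ℝ (green m κ) x (EuclideanSpace.single 0 1)),
    abs_nonneg (fderiv ℝ (green m κ) x (EuclideanSpace.single 1 1))]

theorem locallyIntegrable_norm_rpow {m : ℝ} (hm : 1 < m) :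
    LocallyIntegrable (fun x : Plane => ‖x‖ ^ (m - 3)) volume := by
  refine locallyIntegrable_of_norm_le_rpow (C := 1) (α := 3 - m) (by simp) ?_
    (Eventually.of_forall fun x => ?_)
    (measurable_norm.pow_const _).aestronglyMeasurable
  · simp; linarith
  · rw [Real.norm_of_nonneg (by positivity), one_mul, neg_sub]

theorem locallyIntegrable_kernel {m : ℝ} (hm1 : 1 < m) (hm : m < 2) (κ : ℝ) :
    LocallyIntegrable (kernel m κ) volume := by
  refine locallyIntegrable_of_norm_le_rpow (C := 2 * |κ * (m - 2)|) (α := 3 - m) (by simp) ?_ ?_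
    (measurable_kernel m κ).aestronglyMeasurable
  · simp; linarith
  · filter_upwards [compl_mem_ae_iff.2 (measure_singleton (0 : Plane))] with x hx
    rw [neg_sub]
    exact norm_kernel_le hm κ hx

variable {E' F : Type} [NormedAddCommGroup E'] [NormedSpace ℝ E']
  [NormedAddCommGroup F] [NormedSpace ℝ F]

/-- Near the origin the kernel is integrable, and outside the unit ball it is bounded. The first
part is paired with the bound of `g`, the second with the finite measure of its support. -/
theorem exists_bound_convolution_kernel {m : ℝ} (hm1 : 1 < m) (hm : m < 2) (κ : ℝ)
    (B : E' →L[ℝ] Plane →L[ℝ] F) {g : Plane → E'} (hg : Continuous g)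
    (hgc : HasCompactSupport g) :
    ∃ C, ∀ x, ‖convolution g (kernel m κ) B volume x‖ ≤ C := by
  obtain ⟨A, hA⟩ := hgc.exists_bound_of_continuous hg
  have hA0 : 0 ≤ A := (norm_nonneg _).trans (hA 0)
  set K := tsupport g with hK
  have hKm : MeasurableSet K := (isClosed_tsupport g).measurableSet
  set C₀ := 2 * |κ * (m - 2)| with hC₀
  set κ₁ : Plane → ℝ := (Metric.closedBall (0 : Plane) 1).indicator fun z => ‖kernel m κ z‖ with hκ₁
  have hκ₁i : Integrable κ₁ volume :=
    (integrable_indicator_iff Metric.isClosed_closedBall.measurableSet).2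
      ((locallyIntegrable_kernel hm1 hm κ).integrableOn_isCompact
        (isCompact_closedBall 0 1)).norm
  have hkb : ∀ z, ‖kernel m κ z‖ ≤ κ₁ z + C₀ := by
    intro z
    by_cases hz : z ∈ Metric.closedBall (0 : Plane) 1
    · rw [hκ₁, indicator_of_mem hz]
      have : 0 ≤ C₀ := by positivity
      linarith
    · rw [hκ₁, indicator_of_notMem hz, zero_add]
      rw [mem_closedBall_zero_iff, not_le] at hz
      refine (norm_kernel_le hm κ (norm_pos_iff.1 (by linarith))).trans ?_
      exact mul_le_of_le_one_right (by positivity)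
        (Real.rpow_le_one_of_one_le_of_nonpos hz.le (by linarith))
  have hκ₁0 : ∀ z, 0 ≤ κ₁ z := fun z => indicator_nonneg (fun _ _ => norm_nonneg _) z
  have hi2 : Integrable (K.indicator fun _ : Plane => C₀) volume :=
    (integrable_indicator_iff hKm).2 (integrableOn_const hgc.isCompact.measure_lt_top.ne)
  refine ⟨‖B‖ * A * ((∫ z, κ₁ z) + ∫ z, K.indicator (fun _ => C₀) z), fun x => ?_⟩
  have hi1 : Integrable (fun t => κ₁ (x - t)) volume := hκ₁i.comp_sub_left x
  rw [convolution_def]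
  have := norm_integral_le_of_norm_le (μ := volume)
    (f := fun t => B (g t) (kernel m κ (x - t)))
    (g := fun t => ‖B‖ * A * (κ₁ (x - t) + K.indicator (fun _ => C₀) t))
    ((hi1.add hi2).const_mul _) (Eventually.of_forall fun t => by
      by_cases ht : t ∈ K
      · rw [indicator_of_mem ht]
        calc ‖B (g t) (kernel m κ (x - t))‖ ≤ ‖B‖ * ‖g t‖ * ‖kernel m κ (x - t)‖ :=
              B.le_opNorm₂ _ _
          _ ≤ _ := by gcongr; exacts [hA t, hkb _]
      · rw [image_eq_zero_of_notMem_tsupport ht, indicator_of_notMem ht]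
        simp only [map_zero, zero_apply, norm_zero, add_zero]
        have := hκ₁0 (x - t)
        positivity)
  refine this.trans_eq ?_
  rw [integral_const_mul, integral_add hi1 hi2, integral_sub_left_eq_self κ₁]

/-- Smooth functions all of whose derivatives are bounded. -/
structure SmoothBdd (f : Plane → F) : Prop where
  smooth : ContDiff ℝ ∞ f
  bounded : ∀ n : ℕ, ∃ C, ∀ x, ‖iteratedFDeriv ℝ n f x‖ ≤ C

theorem SmoothBdd.derivative {f : Plane → F} (hf : SmoothBdd f) : SmoothBdd (fderiv ℝ f) where
  smooth := hf.smooth.fderiv_right (by simp)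
  bounded n := by
    obtain ⟨C, hC⟩ := hf.bounded (n + 1)
    exact ⟨C, fun x => by rw [norm_iteratedFDeriv_fderiv]; exact hC x⟩

theorem SmoothBdd.exists_bound {f : Plane → F} (hf : SmoothBdd f) : ∃ C, ∀ x, ‖f x‖ ≤ C := by
  obtain ⟨C, hC⟩ := hf.bounded 0
  exact ⟨C, fun x => by simpa using hC x⟩

/-- All derivatives fall on `g`. Each one changes the target of `g` and the bilinear map, so the
induction runs over all spaces and all `B`. -/
theorem exists_bound_iteratedFDeriv_convolution_kernel {m : ℝ} (hm1 : 1 < m) (hm : m < 2)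
    (κ : ℝ) (n : ℕ) : ∀ {E' F : Type} [NormedAddCommGroup E'] [NormedSpace ℝ E']
    [NormedAddCommGroup F] [NormedSpace ℝ F] (B : E' →L[ℝ] Plane →L[ℝ] F) {g : Plane → E'}
    (_ : ContDiff ℝ ∞ g) (_ : HasCompactSupport g),
    ∃ C, ∀ x, ‖iteratedFDeriv ℝ n (convolution g (kernel m κ) B volume) x‖ ≤ C := by
  induction n with
  | zero =>
    intro E' F _ _ _ _ B g hg hgc
    obtain ⟨C, hC⟩ := exists_bound_convolution_kernel hm1 hm κ B hg.continuous hgc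
    exact ⟨C, fun x => by simpa using hC x⟩
  | succ n ih =>
    intro E' F _ _ _ _ B g hg hgc
    obtain ⟨C, hC⟩ := ih (B.precompL Plane) (hg.fderiv_right (m := ∞) (by simp)) (hgc.fderiv ℝ)
    refine ⟨C, fun x => ?_⟩
    have : fderiv ℝ (convolution g (kernel m κ) B volume)
        = convolution (fderiv ℝ g) (kernel m κ) (B.precompL Plane) volume := by
      funext x
      exact (hgc.hasFDerivAt_convolution_left B (hg.of_le (by simp))
        (locallyIntegrable_kernel hm1 hm κ) x).fderiv
    rw [← norm_iteratedFDeriv_fderiv, this]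
    exact hC x

theorem IsMollifier.contDiff_rescale {ρ : Plane → ℝ} (hρ : IsMollifier ρ) (ε : ℝ) :
    ContDiff ℝ ∞ (rescale ρ ε) :=
  contDiff_const.mul (hρ.smooth.comp (contDiff_const_smul ε⁻¹))

theorem IsMollifier.hasCompactSupport_rescale {ρ : Plane → ℝ} (hρ : IsMollifier ρ) {ε : ℝ}
    (hε : 0 < ε) : HasCompactSupport (rescale ρ ε) :=
  (hρ.compactSupport.comp_smul (inv_ne_zero hε.ne')).mul_left

theorem smoothBdd_regKernel {m κ : ℝ} {ρ : Plane → ℝ} {ε : ℝ} (hm1 : 1 < m) (hm : m < 2)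
    (hρ : IsMollifier ρ) (hε : 0 < ε) : SmoothBdd (regKernel m κ ρ ε) where
  smooth := (hρ.hasCompactSupport_rescale hε).contDiff_convolution_left _
    (hρ.contDiff_rescale ε) (locallyIntegrable_kernel hm1 hm κ)
  bounded n := exists_bound_iteratedFDeriv_convolution_kernel hm1 hm κ n _
    (hρ.contDiff_rescale ε) (hρ.hasCompactSupport_rescale hε)

theorem contDiff_smoothGreen (m κ : ℝ) {δ : ℝ} (hδ : 0 < δ) :
    ContDiff ℝ ∞ (smoothGreen m κ δ) :=
  contDiff_const.mul (((contDiff_norm_sq ℝ).add contDiff_const).rpow_const_of_ne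
    fun x => by positivity)

theorem tendsto_fderiv_smoothGreen (m κ : ℝ) {x : Plane} (hx : x ≠ 0) (v : Plane) :
    Tendsto (fun n : ℕ => fderiv ℝ (smoothGreen m κ (1 / ((n : ℝ) + 1))) x v) atTop
      (𝓝 (fderiv ℝ (green m κ) x v)) := by
  have hx0 : 0 < ‖x‖ := norm_pos_iff.2 hx
  rw [← smoothGreen_zero, (hasFDerivAt_smoothGreen m κ (δ := 0) (x := x) (by positivity)).fderiv]
  have h : ∀ n : ℕ, fderiv ℝ (smoothGreen m κ (1 / ((n : ℝ) + 1))) x v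
      = (κ * (m - 2) * (‖x‖ ^ 2 + 1 / ((n : ℝ) + 1)) ^ ((m - 4) / 2)) * inner ℝ x v := fun n => by
    rw [(hasFDerivAt_smoothGreen m κ (x := x) (by positivity)).fderiv]
    simp
  simp only [h, smul_apply, innerSL_apply_apply, smul_eq_mul]
  refine ((Tendsto.rpow_const ?_ (Or.inl (by positivity))).const_mul _).mul_const _
  exact tendsto_one_div_add_atTop_nhds_zero_nat.const_add _

/-- Integration by parts turns both sides into minus the integral of `G` against a second derivative
of `r`, and second derivatives commute. -/
theorem integral_fderiv_mul_fderiv_comm {r G : Plane → ℝ} (hr : ContDiff ℝ ∞ r)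
    (hrc : HasCompactSupport r) (hG : ContDiff ℝ ∞ G) (v w : Plane) :
    ∫ t, fderiv ℝ r t v * fderiv ℝ G t w = ∫ t, fderiv ℝ r t w * fderiv ℝ G t v := by
  have hrd : ∀ v : Plane, ContDiff ℝ ∞ fun t => fderiv ℝ r t v := fun v =>
    (hr.fderiv_right (m := ∞) (by simp)).clm_apply contDiff_const
  have hrdc : ∀ v : Plane, HasCompactSupport fun t => fderiv ℝ r t v := fun v =>
    hrc.fderiv_apply ℝ v
  have hGd : ∀ v : Plane, ContDiff ℝ ∞ fun t => fderiv ℝ G t v := fun v =>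
    (hG.fderiv_right (m := ∞) (by simp)).clm_apply contDiff_const
  have hpart : ∀ v w : Plane, ∫ t, fderiv ℝ r t v * fderiv ℝ G t w
      = - ∫ t, fderiv ℝ (fun t => fderiv ℝ r t v) t w * G t := by
    intro v w
    have hc2 : HasCompactSupport fun t => fderiv ℝ (fun t => fderiv ℝ r t v) t w :=
      (hrdc v).fderiv_apply ℝ w
    have hd2 : Continuous fun t => fderiv ℝ (fun t => fderiv ℝ r t v) t w :=
      (((hrd v).fderiv_right (m := ∞) (by simp)).clm_apply contDiff_const).continuous
    exact integral_mul_fderiv_eq_neg_fderiv_mul_of_integrable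
      ((hd2.mul hG.continuous).integrable_of_hasCompactSupport hc2.mul_right)
      (((hrd v).continuous.mul (hGd w).continuous).integrable_of_hasCompactSupport
        (hrdc v).mul_right)
      (((hrd v).continuous.mul hG.continuous).integrable_of_hasCompactSupport (hrdc v).mul_right)
      (fun x _ => (hrd v).differentiable (by simp) x) (fun x _ => hG.differentiable (by simp) x)
  rw [hpart, hpart]
  congr 2
  funext t
  have hs : ∀ v w : Plane, fderiv ℝ (fun t => fderiv ℝ r t v) t w
      = fderiv ℝ (fderiv ℝ r) t w v := by
    intro v w
    have h1 : DifferentiableAt ℝ (fderiv ℝ r) t :=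
      (hr.fderiv_right (m := ∞) (by simp)).differentiable (by simp) t
    rw [fderiv_clm_apply h1 (differentiableAt_const v)]
    simp
  rw [hs, hs]
  have hsym : IsSymmSndFDerivAt ℝ r t :=
    hr.contDiffAt.isSymmSndFDerivAt (by
      rw [minSmoothness_of_isRCLikeNormedField]
      exact WithTop.coe_le_coe.2 (le_top : (2 : ℕ∞) ≤ ⊤))
  rw [hsym.eq]

/-- The Green function is singular at the origin, so the identity is proved for `smoothGreen` and
passed to the limit by dominated convergence. -/
theorem integral_fderiv_mul_fderiv_green_comm {m κ : ℝ} (hm1 : 1 < m) (hm : m < 2)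
    {r : Plane → ℝ} (hr : ContDiff ℝ ∞ r) (hrc : HasCompactSupport r) (x v w : Plane) :
    Integrable (fun t => fderiv ℝ r t v * fderiv ℝ (green m κ) (x - t) w) volume ∧
    ∫ t, fderiv ℝ r t v * fderiv ℝ (green m κ) (x - t) w
      = ∫ t, fderiv ℝ r t w * fderiv ℝ (green m κ) (x - t) v := by
  have hrd : ∀ v : Plane, Continuous fun t => fderiv ℝ r t v := fun v =>
    ((hr.fderiv_right (m := ∞) (by simp)).clm_apply contDiff_const).continuous
  have hrdc : ∀ v : Plane, HasCompactSupport fun t => fderiv ℝ r t v := fun v =>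
    hrc.fderiv_apply ℝ v
  have hdom : ∀ v w : Plane, Integrable
      (fun t => |fderiv ℝ r t v| * (|κ * (m - 2)| * ‖x - t‖ ^ (m - 3) * ‖w‖)) volume := by
    intro v w
    have hL : LocallyIntegrable (fun t : Plane => ‖x - t‖ ^ (m - 3)) volume := by
      intro y
      obtain ⟨U, hU, hUi⟩ := locallyIntegrable_norm_rpow hm1 (x - y)
      refine ⟨(fun t => x - t) ⁻¹' U, (continuous_const.sub continuous_id).continuousAt hU, ?_⟩
      exact ((Measure.measurePreserving_sub_left volume x).integrableOn_comp_preimage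
        (Homeomorph.subLeft x).measurableEmbedding).2 hUi
    have h2 := hL.integrable_smul_left_of_hasCompactSupport
      (((hrd v).abs).mul continuous_const (g := fun _ => |κ * (m - 2)| * ‖w‖))
      (((hrdc v).comp_left abs_zero).mul_right)
    refine h2.congr (Eventually.of_forall fun t => ?_)
    simp only [smul_eq_mul, Pi.mul_apply]
    ring
  have hne : ∀ᵐ t ∂(volume : Measure Plane), x - t ≠ 0 := by
    filter_upwards [compl_mem_ae_iff.2 (measure_singleton (x : Plane))] with t ht h
    exact ht (sub_eq_zero.1 h).symm
  have hmeas : ∀ (G : Plane → ℝ) (v w : Plane), AEStronglyMeasurable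
      (fun t => fderiv ℝ r t v * fderiv ℝ G (x - t) w) volume := fun G v w =>
    ((hrd v).measurable.mul ((measurable_fderiv_apply_const ℝ G w).comp
      (measurable_const.sub measurable_id))).aestronglyMeasurable
  have hbd : ∀ (δ : ℝ), 0 ≤ δ → ∀ v w : Plane, ∀ᵐ t ∂(volume : Measure Plane),
      ‖fderiv ℝ r t v * fderiv ℝ (smoothGreen m κ δ) (x - t) w‖
        ≤ |fderiv ℝ r t v| * (|κ * (m - 2)| * ‖x - t‖ ^ (m - 3) * ‖w‖) := by
    intro δ hδ v w
    filter_upwards [hne] with t ht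
    rw [norm_mul, Real.norm_eq_abs, Real.norm_eq_abs]
    exact mul_le_mul_of_nonneg_left (abs_fderiv_smoothGreen_le hm κ hδ ht w) (abs_nonneg _)
  have hlim : ∀ v w : Plane, Tendsto (fun n : ℕ => ∫ t, fderiv ℝ r t v
      * fderiv ℝ (smoothGreen m κ (1 / ((n : ℝ) + 1))) (x - t) w) atTop
      (𝓝 (∫ t, fderiv ℝ r t v * fderiv ℝ (green m κ) (x - t) w)) := by
    intro v w
    refine tendsto_integral_of_dominated_convergence _ (fun n => hmeas _ v w) (hdom v w)
      (fun n => hbd _ (by positivity) v w) ?_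
    filter_upwards [hne] with t ht
    exact (tendsto_fderiv_smoothGreen m κ ht w).const_mul _
  refine ⟨(hdom v w).mono' (hmeas _ v w) ?_, ?_⟩
  · have := hbd 0 le_rfl v w
    rwa [smoothGreen_zero] at this
  · refine tendsto_nhds_unique (hlim v w) ((hlim w v).congr fun n => ?_)
    have hG := contDiff_smoothGreen m κ (δ := 1 / ((n : ℝ) + 1)) (by positivity)
    have hG' : ContDiff ℝ ∞ fun t => smoothGreen m κ (1 / ((n : ℝ) + 1)) (x - t) :=
      hG.comp (contDiff_const.sub contDiff_id)
    have hd : ∀ t w : Plane, fderiv ℝ (fun t => smoothGreen m κ (1 / ((n : ℝ) + 1)) (x - t)) t w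
        = - fderiv ℝ (smoothGreen m κ (1 / ((n : ℝ) + 1))) (x - t) w := by
      intro t w
      have h1 := (hG.differentiable (by simp) (x - t)).hasFDerivAt.comp t
        ((hasFDerivAt_const x t).sub (hasFDerivAt_id t))
      have h2 : fderiv ℝ (fun t => smoothGreen m κ (1 / ((n : ℝ) + 1)) (x - t)) t = _ := h1.fderiv
      rw [h2]
      simp
    have := integral_fderiv_mul_fderiv_comm hr hrc hG' w v
    -- The reflection $t\mapsto x-t$ produces the same sign on both sides.
    simp only [hd, mul_neg, integral_neg, neg_inj] at this
    exact this

/-- The trace as a continuous linear functional. -/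
def ptraceL : (Plane →L[ℝ] Plane) →L[ℝ] ℝ :=
  (EuclideanSpace.proj (0 : Fin 2)).comp
      (ContinuousLinearMap.apply ℝ Plane (EuclideanSpace.single (0 : Fin 2) (1 : ℝ)))
    + (EuclideanSpace.proj (1 : Fin 2)).comp
      (ContinuousLinearMap.apply ℝ Plane (EuclideanSpace.single (1 : Fin 2) (1 : ℝ)))

theorem ptraceL_apply (A : Plane →L[ℝ] Plane) : ptraceL A = ptrace A := rfl

/-- With the derivative on $r=\rho_\epsilon$, the divergence is
$\int(\partial_2r\,\partial_1G-\partial_1r\,\partial_2G)$, with $G$ evaluated at $x-t$. It vanishes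
by the symmetry just proved, and the kernel itself is never differentiated. -/
theorem ptrace_fderiv_regKernel {m κ : ℝ} {ρ : Plane → ℝ} {ε : ℝ} (hm1 : 1 < m) (hm : m < 2)
    (hρ : IsMollifier ρ) (hε : 0 < ε) (x : Plane) :
    ptrace (fderiv ℝ (regKernel m κ ρ ε) x) = 0 := by
  have hr := hρ.contDiff_rescale ε
  have hrc := hρ.hasCompactSupport_rescale hε
  have hk := locallyIntegrable_kernel hm1 hm κ
  rw [regKernel, (hrc.hasFDerivAt_convolution_left _ (hr.of_le (by simp)) hk x).fderiv,
    convolution_def, ← ptraceL_apply, ← ContinuousLinearMap.integral_comp_comm]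
  · have h1 := integral_fderiv_mul_fderiv_green_comm (κ := κ) hm1 hm hr hrc x
      (EuclideanSpace.single 0 1) (EuclideanSpace.single 1 1)
    have h2 := integral_fderiv_mul_fderiv_green_comm (κ := κ) hm1 hm hr hrc x
      (EuclideanSpace.single 1 1) (EuclideanSpace.single 0 1)
    have h3 := integral_sub h2.1 h1.1
    rw [h1.2, sub_self] at h3
    rw [← h3]
    congr 1
    funext t
    rw [ptraceL_apply]
    simp only [ptrace, ContinuousLinearMap.precompL_apply, ContinuousLinearMap.lsmul_apply,
      PiLp.smul_apply, smul_eq_mul, kernel, perpGrad, Matrix.cons_val_zero, Matrix.cons_val_one]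
    ring
  · exact (hrc.fderiv ℝ).convolutionExists_left _ (hr.continuous_fderiv (by simp)) hk x

/-- The set where the bound holds is closed, and it is dense since it has full measure. -/
theorem norm_le_of_eLpNorm_top_le {F : Type*} [NormedAddCommGroup F] {f : Plane → F} (hf : Continuous f)
    {c : ℝ≥0} (h : eLpNorm f ⊤ volume ≤ c) (x : Plane) : ‖f x‖ ≤ c := by
  have h1 : ∀ᵐ y ∂(volume : Measure Plane), ‖f y‖ ≤ c := by
    rw [eLpNorm_exponent_top] at h
    filter_upwards [ae_le_eLpNormEssSup (f := f) (μ := volume)] with y hy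
    have := hy.trans h
    rw [enorm_eq_nnnorm] at this
    exact_mod_cast this
  have h2 : IsClosed {y | ‖f y‖ ≤ c} := isClosed_le hf.norm continuous_const
  have h3 := (Measure.dense_of_ae h1).closure_eq
  rw [h2.closure_eq] at h3
  have : x ∈ {y | ‖f y‖ ≤ c} := h3 ▸ mem_univ x
  exact this

theorem kernelConst_ne_top {k : Plane → Plane} (hk : SmoothBdd k) : kernelConst k ≠ ⊤ := by
  obtain ⟨C, hC⟩ := hk.exists_bound
  obtain ⟨C', hC'⟩ := hk.derivative.exists_bound
  refine (max_lt ?_ ?_).ne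
  · exact ENNReal.mul_lt_top (by simp)
      ((memLp_top_of_bound hk.smooth.continuous.aestronglyMeasurable C
        (Eventually.of_forall hC)).eLpNorm_lt_top)
  · exact (memLp_top_of_bound hk.derivative.smooth.continuous.aestronglyMeasurable C'
      (Eventually.of_forall hC')).eLpNorm_lt_top

/-- This explains the form of `kernelConst`: $2\|k\|_\infty$ bounds the oscillation and $\|\nabla
k\|_\infty$ the Lipschitz constant, and together they give a Lipschitz bound for the metric
$\min(1,|a-b|)$. -/
theorem norm_sub_le_kernelConst {k : Plane → Plane} (hk : SmoothBdd k) (a b : Plane) :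
    ‖k a - k b‖ ≤ (kernelConst k).toNNReal * min 1 ‖a - b‖ := by
  set c := (kernelConst k).toNNReal with hc
  have hcc : (c : ℝ≥0∞) = kernelConst k := ENNReal.coe_toNNReal (kernelConst_ne_top hk)
  have h1 : ∀ x, ‖k x‖ ≤ (c / 2 : ℝ≥0) := by
    apply norm_le_of_eLpNorm_top_le hk.smooth.continuous
    have : 2 * eLpNorm k ⊤ volume ≤ c := hcc ▸ le_max_left _ _
    rw [ENNReal.coe_div two_ne_zero, ENNReal.le_div_iff_mul_le (by simp) (by simp), mul_comm]
    exact this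
  have h2 : ∀ x, ‖fderiv ℝ k x‖ ≤ c := by
    apply norm_le_of_eLpNorm_top_le hk.derivative.smooth.continuous
    exact hcc ▸ le_max_right _ _
  have h3 : LipschitzWith c k :=
    lipschitzWith_of_nnnorm_fderiv_le (hk.smooth.differentiable (by simp)) fun x => h2 x
  rw [mul_min_of_nonneg _ _ c.coe_nonneg]
  refine le_min ?_ ?_
  · have := norm_sub_le (k a) (k b)
    have ha := h1 a
    have hb := h1 b
    push_cast at ha hb
    linarith
  · simpa [dist_eq_norm] using h3.dist_le_mul a b

end Kernel

/-! ### Convolution of smooth kernels with signed measures -/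

section SignedConvolution

variable {F : Type} [NormedAddCommGroup F] [NormedSpace ℝ F]

/-- The convolution of a function with a signed measure. -/
def sconv (μ : SignedMeasure Plane) (f : Plane → F) (x : Plane) : F :=
  sintegral μ fun y => f (x - y)

theorem velocity_eq_sconv (k : Plane → Plane) (μ : SignedMeasure Plane) :
    velocity k μ = sconv μ k := rfl

theorem SmoothBdd.integrable_comp_sub {f : Plane → F} (hf : SmoothBdd f) (ν : Measure Plane)
    [IsFiniteMeasure ν] (x : Plane) : Integrable (fun y => f (x - y)) ν := by
  obtain ⟨C, hC⟩ := hf.exists_bound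
  exact integrable_of_continuous_bounded (hf.smooth.continuous.comp (by fun_prop))
    (fun y => hC (x - y))

theorem SmoothBdd.hasFDerivAt_integral {f : Plane → F} (hf : SmoothBdd f) (ν : Measure Plane)
    [IsFiniteMeasure ν] (x : Plane) :
    HasFDerivAt (fun x => ∫ y, f (x - y) ∂ν) (∫ y, fderiv ℝ f (x - y) ∂ν) x := by
  obtain ⟨C, hC⟩ := hf.derivative.exists_bound
  refine hasFDerivAt_integral_of_dominated_of_fderiv_le (s := univ) (bound := fun _ => C)
    (F' := fun x y => fderiv ℝ f (x - y)) univ_mem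
    (Eventually.of_forall fun x => (hf.integrable_comp_sub ν x).aestronglyMeasurable)
    (hf.integrable_comp_sub ν x) (hf.derivative.integrable_comp_sub ν x).aestronglyMeasurable
    (Eventually.of_forall fun y z _ => hC _) (integrable_const C)
    (Eventually.of_forall fun y z _ => ?_)
  have h1 := ((hf.smooth.differentiable (by simp)) (z - y)).hasFDerivAt
  have h2 := h1.comp z ((hasFDerivAt_id z).sub_const y)
  rwa [ContinuousLinearMap.comp_id] at h2

theorem SmoothBdd.hasFDerivAt_sconv {f : Plane → F} (hf : SmoothBdd f) (μ : SignedMeasure Plane)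
    (x : Plane) : HasFDerivAt (sconv μ f) (sconv μ (fderiv ℝ f) x) x :=
  (hf.hasFDerivAt_integral _ x).sub (hf.hasFDerivAt_integral _ x)

theorem SmoothBdd.fderiv_sconv {f : Plane → F} (hf : SmoothBdd f) (μ : SignedMeasure Plane) :
    fderiv ℝ (sconv μ f) = sconv μ (fderiv ℝ f) :=
  funext fun x => (hf.hasFDerivAt_sconv μ x).fderiv

/-- The derivative is again a convolution, of the derivative of `f`; the target space changes, so
the induction is over all of them. -/
theorem contDiff_sconv_nat (μ : SignedMeasure Plane) (n : ℕ) :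
    ∀ {F : Type} [NormedAddCommGroup F] [NormedSpace ℝ F] {f : Plane → F},
      SmoothBdd f → ContDiff ℝ n (sconv μ f) := by
  induction n with
  | zero =>
    intro F _ _ f hf
    exact contDiff_zero.2 (continuous_iff_continuousAt.2 fun x =>
      (hf.hasFDerivAt_sconv μ x).continuousAt)
  | succ n ih =>
    intro F _ _ f hf
    exact contDiff_succ_iff_hasFDerivAt.2 ⟨_, ih hf.derivative, hf.hasFDerivAt_sconv μ⟩

theorem SmoothBdd.contDiff_sconv {f : Plane → F} (hf : SmoothBdd f) (μ : SignedMeasure Plane) :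
    ContDiff ℝ ∞ (sconv μ f) :=
  contDiff_infty.2 fun n => contDiff_sconv_nat μ n hf

theorem norm_sconv_le {μ : SignedMeasure Plane} {f : Plane → F} {C M : ℝ}
    (hC : ∀ x, ‖f x‖ ≤ C) (hM : μ.totalVariation.real univ ≤ M) (x : Plane) :
    ‖sconv μ f x‖ ≤ C * M :=
  norm_sintegral_le ((norm_nonneg _).trans (hC 0)) (fun _ => hC _) hM

theorem SmoothBdd.norm_sconv_sub_le {f : Plane → F} (hf : SmoothBdd f) {μ : SignedMeasure Plane}
    {C M : ℝ} (hC : ∀ x, ‖fderiv ℝ f x‖ ≤ C) (hM : μ.totalVariation.real univ ≤ M)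
    (x y : Plane) : ‖sconv μ f x - sconv μ f y‖ ≤ C * M * ‖x - y‖ :=
  convex_univ.norm_image_sub_le_of_norm_hasFDerivWithin_le
    (fun z _ => (hf.hasFDerivAt_sconv μ z).hasFDerivWithinAt)
    (fun z _ => norm_sconv_le hC hM z) (mem_univ y) (mem_univ x)

theorem ptrace_fderiv_velocity {k : Plane → Plane} (hk : SmoothBdd k)
    (hdiv : ∀ x, ptrace (fderiv ℝ k x) = 0) (μ : SignedMeasure Plane) (x : Plane) :
    ptrace (fderiv ℝ (velocity k μ) x) = 0 := by
  rw [velocity_eq_sconv, hk.fderiv_sconv, ← ptraceL_apply, sconv, sintegral, map_sub,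
    ← ptraceL.integral_comp_comm (hk.derivative.integrable_comp_sub _ x),
    ← ptraceL.integral_comp_comm (hk.derivative.integrable_comp_sub _ x)]
  simp [ptraceL_apply, hdiv]

theorem inner_sintegral {μ : SignedMeasure Plane} {f : Plane → Plane}
    (hf : Integrable f μ.totalVariation) (e : Plane) :
    inner ℝ e (sintegral μ f) = sintegral μ fun y => inner ℝ e (f y) := by
  rw [integrable_totalVariation_iff] at hf
  rw [sintegral, inner_sub_right, ← integral_inner hf.1, ← integral_inner hf.2]
  rfl

end SignedConvolution

/-! ### Weak solutions and the regularity of their velocity fields -/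

section Weak

/-- Smooth cutoffs with uniformly bounded gradients that increase to `1`. -/
theorem exists_cutoff : ∃ (D : ℝ) (χ : ℕ → Plane → ℝ), 0 ≤ D ∧ (∀ n, ContDiff ℝ ∞ (χ n)) ∧
    (∀ n, HasCompactSupport (χ n)) ∧ (∀ n x, |χ n x| ≤ 1) ∧ (∀ n x, ‖fderiv ℝ (χ n) x‖ ≤ D) ∧
    ∀ x, Tendsto (fun n => χ n x) atTop (𝓝 1) := by
  let χ : ContDiffBump (0 : Plane) := ⟨1, 2, one_pos, one_lt_two⟩
  have hχ : ContDiff ℝ ∞ χ := χ.contDiff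
  obtain ⟨D, hD⟩ := (χ.hasCompactSupport.fderiv ℝ).exists_bound_of_continuous
    (hχ.continuous_fderiv (by simp))
  have hD0 : 0 ≤ D := (norm_nonneg _).trans (hD 0)
  refine ⟨D, fun n x => χ (((n : ℝ) + 1)⁻¹ • x), hD0, fun n => hχ.comp (contDiff_const_smul _),
    fun n => χ.hasCompactSupport.comp_smul (by positivity), fun n x => ?_, fun n x => ?_,
    fun x => ?_⟩
  · rw [abs_of_nonneg χ.nonneg]
    exact χ.le_one
  · have h1 := ((hχ.differentiable (by simp)) (((n : ℝ) + 1)⁻¹ • x)).hasFDerivAt.comp x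
      ((hasFDerivAt_id x).const_smul (((n : ℝ) + 1)⁻¹))
    have h2 : fderiv ℝ (fun x => χ (((n : ℝ) + 1)⁻¹ • x)) x = _ := h1.fderiv
    rw [h2, ContinuousLinearMap.comp_smul, ContinuousLinearMap.comp_id, norm_smul]
    have h3 : ‖((n : ℝ) + 1)⁻¹‖ ≤ 1 := by
      rw [Real.norm_of_nonneg (by positivity)]
      exact inv_le_one_of_one_le₀ (by linarith [n.cast_nonneg (α := ℝ)])
    calc _ ≤ 1 * D := mul_le_mul h3 (hD _) (norm_nonneg _) zero_le_one
      _ = D := one_mul D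
  · obtain ⟨N, hN⟩ := exists_nat_ge ‖x‖
    refine tendsto_const_nhds.congr' ?_
    filter_upwards [eventually_ge_atTop N] with n hn
    have hn' : (N : ℝ) ≤ n := by exact_mod_cast hn
    symm
    apply χ.one_of_mem_closedBall
    rw [mem_closedBall_zero_iff, norm_smul, Real.norm_of_nonneg (by positivity),
      inv_mul_le_iff₀ (by positivity)]
    change ‖x‖ ≤ ((n : ℝ) + 1) * 1
    linarith

/-- `θ` solves on `[0, T]` the linear continuity equation with the velocity field `u`, and its
total variation is bounded by `M`. -/
structure IsLinearSolution (u : ℝ → Plane → Plane) (θ : ℝ → SignedMeasure Plane) (T M : ℝ) :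
    Prop where
  bound : ∀ t ∈ Icc 0 T, (θ t).totalVariation.real univ ≤ M
  integrable : ∀ φ : Plane → ℝ, ContDiff ℝ ∞ φ → HasCompactSupport φ →
    ∀ s ∈ Icc 0 T, ∀ t ∈ Icc 0 T, IntervalIntegrable
      (fun r => sintegral (θ r) fun x => fderiv ℝ φ x (u r x)) volume s t
  weak_eq : ∀ φ : Plane → ℝ, ContDiff ℝ ∞ φ → HasCompactSupport φ →
    ∀ s ∈ Icc 0 T, ∀ t ∈ Icc 0 T, sintegral (θ t) φ - sintegral (θ s) φ
      = ∫ r in s..t, sintegral (θ r) fun x => fderiv ℝ φ x (u r x)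

variable {u : ℝ → Plane → Plane} {θ : ℝ → SignedMeasure Plane} {T M : ℝ}

theorem IsSolution.zero {k : Plane → Plane} {θ₀ : SignedMeasure Plane}
    (h : IsSolution k θ₀ θ) : θ 0 = θ₀ :=
  signedMeasure_ext_of_contDiff fun φ hφ hc => by
    have := h.weak_eq φ hφ hc 0 le_rfl
    simp only [intervalIntegral.integral_same] at this
    linarith

theorem IsSolution.isLinearSolution {k : Plane → Plane} {θ₀ : SignedMeasure Plane}
    (h : IsSolution k θ₀ θ) (hM : ∀ t ∈ Icc 0 T, (θ t).totalVariation.real univ ≤ M) :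
    IsLinearSolution (fun t => velocity k (θ t)) θ T M where
  bound := hM
  integrable φ hφ hc s hs t ht :=
    (h.integrable φ hφ hc s hs.1).symm.trans (h.integrable φ hφ hc t ht.1)
  weak_eq φ hφ hc s hs t ht := by
    rw [← intervalIntegral.integral_interval_sub_left (h.integrable φ hφ hc t ht.1)
      (h.integrable φ hφ hc s hs.1), ← h.weak_eq φ hφ hc t ht.1, ← h.weak_eq φ hφ hc s hs.1]
    ring

theorem IsLinearSolution.congr {v : ℝ → Plane → Plane} (h : IsLinearSolution u θ T M)
    (huv : ∀ t ∈ Icc 0 T, u t = v t) : IsLinearSolution v θ T M where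
  bound := h.bound
  integrable φ hφ hc s hs t ht := by
    refine (h.integrable φ hφ hc s hs t ht).congr fun r hr => ?_
    have hr' : r ∈ Icc 0 T := uIcc_subset_Icc hs ht (uIoc_subset_uIcc hr)
    simp only [huv r hr']
  weak_eq φ hφ hc s hs t ht := by
    rw [h.weak_eq φ hφ hc s hs t ht]
    refine intervalIntegral.integral_congr fun r hr => ?_
    simp only [huv r (uIcc_subset_Icc hs ht hr)]

theorem IsLinearSolution.abs_sub_le (h : IsLinearSolution u θ T M) {B : ℝ}
    (hu : ∀ t ∈ Icc 0 T, ∀ x, ‖u t x‖ ≤ B) {φ : Plane → ℝ} (hφ : ContDiff ℝ ∞ φ)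
    (hc : HasCompactSupport φ) {A : ℝ} (hA : ∀ x, ‖fderiv ℝ φ x‖ ≤ A) {s t : ℝ}
    (hs : s ∈ Icc 0 T) (ht : t ∈ Icc 0 T) :
    |sintegral (θ t) φ - sintegral (θ s) φ| ≤ A * B * M * |t - s| := by
  have hA0 : 0 ≤ A := (norm_nonneg _).trans (hA 0)
  have hB0 : 0 ≤ B := (norm_nonneg _).trans (hu s hs 0)
  rw [h.weak_eq φ hφ hc s hs t ht, ← Real.norm_eq_abs]
  refine intervalIntegral.norm_integral_le_of_norm_le_const fun r hr => ?_
  have hr' : r ∈ Icc 0 T := uIcc_subset_Icc hs ht (uIoc_subset_uIcc hr)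
  refine norm_sintegral_le (mul_nonneg hA0 hB0) (fun x => ?_) (h.bound r hr')
  exact ((fderiv ℝ φ x).le_opNorm _).trans
    (mul_le_mul (hA x) (hu r hr' x) (norm_nonneg _) hA0)

theorem tendsto_sintegral_of_bounded (μ : SignedMeasure Plane) {f : ℕ → Plane → ℝ}
    {g : Plane → ℝ} (hf : ∀ n, Continuous (f n)) {C : ℝ} (hC : ∀ n x, ‖f n x‖ ≤ C)
    (hlim : ∀ x, Tendsto (fun n => f n x) atTop (𝓝 (g x))) :
    Tendsto (fun n => sintegral μ (f n)) atTop (𝓝 (sintegral μ g)) := by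
  have key : ∀ (ν : Measure Plane) [IsFiniteMeasure ν],
      Tendsto (fun n => ∫ x, f n x ∂ν) atTop (𝓝 (∫ x, g x ∂ν)) := fun ν _ =>
    tendsto_integral_of_dominated_convergence (fun _ => C)
      (fun n => (hf n).aestronglyMeasurable) (integrable_const C)
      (fun n => Eventually.of_forall (hC n)) (Eventually.of_forall hlim)
  exact (key _).sub (key _)

/-- The continuity in time extends to test functions that need not vanish at infinity. -/
theorem exists_abs_sub_le_of_bounded : ∃ D : ℝ, 0 ≤ D ∧
    ∀ {u : ℝ → Plane → Plane} {θ : ℝ → SignedMeasure Plane} {T M : ℝ}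
      (_ : IsLinearSolution u θ T M) {B : ℝ} (_ : 0 ≤ M)
      (_ : ∀ t ∈ Icc 0 T, ∀ x, ‖u t x‖ ≤ B) {φ : Plane → ℝ} (_ : ContDiff ℝ ∞ φ) {A : ℝ}
      (_ : ∀ x, |φ x| ≤ A) (_ : ∀ x, ‖fderiv ℝ φ x‖ ≤ A) {s t : ℝ} (_ : s ∈ Icc 0 T)
      (_ : t ∈ Icc 0 T),
      |sintegral (θ t) φ - sintegral (θ s) φ| ≤ A * (D + 1) * B * M * |t - s| := by
  obtain ⟨D, χ, hD, hχ, hχc, hχ1, hχD, hlim⟩ := exists_cutoff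
  refine ⟨D, hD, ?_⟩
  intro u θ T M h B hM hu φ hφ A hA hA' s t hs ht
  have hA0 : 0 ≤ A := (norm_nonneg _).trans (hA' 0)
  -- The cutoffs have gradients bounded by `D` uniformly in `n`, so the estimate for compactly
  -- supported functions passes to the limit.
  have hprod : ∀ n x, ‖fderiv ℝ (fun y => φ y * χ n y) x‖ ≤ A * (D + 1) := by
    intro n x
    have h1 := (hφ.differentiable (by simp) x).hasFDerivAt.mul
      ((hχ n).differentiable (by simp) x).hasFDerivAt
    have h2 : fderiv ℝ (fun y => φ y * χ n y) x = _ := h1.fderiv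
    rw [h2]
    calc _ ≤ _ := norm_add_le _ _
      _ ≤ A * D + 1 * A := by
        rw [norm_smul, norm_smul, Real.norm_eq_abs, Real.norm_eq_abs]
        exact add_le_add (mul_le_mul (hA x) (hχD n x) (norm_nonneg _) hA0)
          (mul_le_mul (hχ1 n x) (hA' x) (norm_nonneg _) zero_le_one)
      _ = _ := by ring
  have hb : ∀ n, |sintegral (θ t) (fun y => φ y * χ n y) - sintegral (θ s) (fun y => φ y * χ n y)|
      ≤ A * (D + 1) * B * M * |t - s| := fun n =>
    h.abs_sub_le hu (hφ.mul (hχ n)) (hχc n).mul_left (hprod n) hs ht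
  have hconv : ∀ μ : SignedMeasure Plane, Tendsto (fun n => sintegral μ fun y => φ y * χ n y)
      atTop (𝓝 (sintegral μ φ)) := fun μ =>
    tendsto_sintegral_of_bounded μ (C := A) (fun n => hφ.continuous.mul (hχ n).continuous)
      (fun n x => by
        rw [norm_mul, Real.norm_eq_abs, Real.norm_eq_abs]
        exact (mul_le_mul (hA x) (hχ1 n x) (abs_nonneg _) hA0).trans_eq (mul_one A))
      (fun x => by simpa using (hlim x).const_mul (φ x))
  exact le_of_tendsto ((hconv _).sub (hconv _)).abs (Eventually.of_forall hb)

/-- The velocity field of a solution, with the time frozen outside of `[0, T]`, is regular. -/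
theorem IsSolution.exists_regField {k : Plane → Plane} (hk : SmoothBdd k)
    {θ₀ : SignedMeasure Plane} (h : IsSolution k θ₀ θ) (hT : 0 ≤ T)
    (hM : ∀ t ∈ Icc 0 T, (θ t).totalVariation.real univ ≤ M) :
    ∃ L : ℝ≥0, RegField (fun t => velocity k (θ (projIcc 0 T hT t))) L := by
  obtain ⟨K₀, hK₀⟩ := hk.exists_bound
  obtain ⟨K₁, hK₁⟩ := hk.derivative.exists_bound
  obtain ⟨K₂, hK₂⟩ := hk.derivative.derivative.exists_bound
  obtain ⟨D, hD, hlip⟩ := exists_abs_sub_le_of_bounded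
  have hM0 : 0 ≤ M := measureReal_nonneg.trans (hM 0 ⟨le_rfl, hT⟩)
  have hK₀0 : 0 ≤ K₀ := (norm_nonneg _).trans (hK₀ 0)
  have hK₁0 : 0 ≤ K₁ := (norm_nonneg _).trans (hK₁ 0)
  have hK₂0 : 0 ≤ K₂ := (norm_nonneg _).trans (hK₂ 0)
  set K := K₀ + K₁ with hKdef
  -- The first summand covers the bounds in space. The second is the Lipschitz constant in time,
  -- from test functions bounded with their gradients by `K` times a norm and a velocity bounded by
  -- $K_0M$.
  set L : ℝ := (K₀ + K₁ + K₂) * M + K * (D + 1) * (K₀ * M) * M with hL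
  have hterm : 0 ≤ K * (D + 1) * (K₀ * M) * M := by positivity
  have hL0 : 0 ≤ L := by positivity
  have hmem : ∀ t, (projIcc 0 T hT t : ℝ) ∈ Icc 0 T := fun t => (projIcc 0 T hT t).2
  have hle : ∀ {C : ℝ}, C ≤ K₀ + K₁ + K₂ → C * M ≤ L := fun {C} hC => by
    have := mul_le_mul_of_nonneg_right hC hM0
    linarith
  have hlin := h.isLinearSolution hM
  have htime : ∀ s ∈ Icc 0 T, ∀ t ∈ Icc 0 T, ∀ x,
      ‖velocity k (θ s) x - velocity k (θ t) x‖ ≤ L * |s - t| := by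
    intro s hs t ht x
    -- The test function is $y\mapsto\langle w,k(x-y)\rangle$ with `w` the difference to be
    -- estimated. The change of its integral is $\|w\|^2$ while its bounds are proportional to
    -- $\|w\|$, so one factor cancels.
    set w := velocity k (θ s) x - velocity k (θ t) x with hw
    have hint : ∀ μ : SignedMeasure Plane, inner ℝ w (velocity k μ x)
        = sintegral μ fun y => inner ℝ w (k (x - y)) := fun μ =>
      inner_sintegral (hk.integrable_comp_sub _ x) w
    have hcd : ContDiff ℝ ∞ fun y => inner ℝ w (k (x - y)) :=
      contDiff_const.inner ℝ (hk.smooth.comp (contDiff_const.sub contDiff_id))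
    have hfd : ∀ y, ‖fderiv ℝ (fun y => inner ℝ w (k (x - y))) y‖ ≤ ‖w‖ * K := by
      intro y
      have hlipk : LipschitzWith ⟨K₁, hK₁0⟩ k :=
        lipschitzWith_of_nnnorm_fderiv_le (hk.smooth.differentiable (by simp)) fun x => hK₁ x
      have : LipschitzWith (‖w‖₊ * ⟨K, by positivity⟩) fun y => inner ℝ w (k (x - y)) := by
        refine LipschitzWith.of_dist_le_mul fun y z => ?_
        rw [Real.dist_eq, ← inner_sub_right]
        have h1 := hlipk.dist_le_mul (x - y) (x - z)
        rw [dist_sub_left, dist_eq_norm (k _)] at h1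
        calc |inner ℝ w (k (x - y) - k (x - z))| ≤ ‖w‖ * ‖k (x - y) - k (x - z)‖ :=
              abs_real_inner_le_norm _ _
          _ ≤ ‖w‖ * (K * dist y z) := by
              gcongr
              refine h1.trans ?_
              change K₁ * dist y z ≤ K * dist y z
              gcongr
              linarith
          _ = _ := (mul_assoc ‖w‖ K _).symm
      exact norm_fderiv_le_of_lipschitz ℝ this
    have hbd : ∀ y, |inner ℝ w (k (x - y))| ≤ ‖w‖ * K := fun y =>
      (abs_real_inner_le_norm _ _).trans
        (mul_le_mul_of_nonneg_left ((hK₀ _).trans (by linarith)) (norm_nonneg _))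
    have h1 := hlip hlin hM0 (B := K₀ * M) (fun r hr y => norm_sconv_le hK₀ (hM r hr) y) hcd hbd hfd
      ht hs
    rw [← hint, ← hint, ← inner_sub_right, ← hw, real_inner_self_eq_norm_sq,
      abs_of_nonneg (sq_nonneg _)] at h1
    have h2 : ‖w‖ * ‖w‖ ≤ ‖w‖ * (L * |s - t|) := by
      calc ‖w‖ * ‖w‖ = ‖w‖ ^ 2 := (sq _).symm
        _ ≤ _ := h1
        _ = ‖w‖ * ((K * (D + 1) * (K₀ * M) * M) * |s - t|) := by ring
        _ ≤ _ := by
          gcongr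
          rw [hL]
          have : 0 ≤ (K₀ + K₁ + K₂) * M := by positivity
          linarith
    rcases (norm_nonneg w).eq_or_lt with h0 | h0
    · rw [← h0]; positivity
    · exact le_of_mul_le_mul_left h2 h0
  refine ⟨⟨L, hL0⟩, fun t => hk.contDiff_sconv _, fun t x => ?_, fun t x => ?_, fun t x y => ?_,
    fun s t x => ?_⟩
  · exact (norm_sconv_le hK₀ (hM _ (hmem t)) x).trans (hle (by linarith))
  · rw [velocity_eq_sconv, hk.fderiv_sconv]
    exact (norm_sconv_le hK₁ (hM _ (hmem t)) x).trans (hle (by linarith))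
  · rw [velocity_eq_sconv, hk.fderiv_sconv]
    exact (hk.derivative.norm_sconv_sub_le hK₂ (hM _ (hmem t)) x y).trans
      (mul_le_mul_of_nonneg_right (hle (by linarith)) (norm_nonneg _))
  · refine (htime _ (hmem s) _ (hmem t) x).trans (mul_le_mul_of_nonneg_left ?_ hL0)
    exact abs_projIcc_sub_projIcc hT

end Weak

/-! ### Solutions of the linear equation are transported by the flow -/

section Duality

/-- Test functions with a bound `A` for the derivative and a Lipschitz constant `B` of the
derivative. -/
structure TestBound (φ : Plane → ℝ) (A B : ℝ) : Prop where
  smooth : ContDiff ℝ ∞ φ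
  compactSupport : HasCompactSupport φ
  nonneg : 0 ≤ B
  fderiv_bound : ∀ x, ‖fderiv ℝ φ x‖ ≤ A
  fderiv_lip : ∀ x y, ‖fderiv ℝ φ x - fderiv ℝ φ y‖ ≤ B * ‖x - y‖

variable {u : ℝ → Plane → Plane} {L : ℝ≥0} {X : ℝ → Plane → Plane}
  {θ : ℝ → SignedMeasure Plane} {T M : ℝ} {φ : Plane → ℝ} {A B : ℝ}

theorem exists_bound_fderiv {F : Type*} [NormedAddCommGroup F] [NormedSpace ℝ F] {f : Plane → F}
    (hf : ContDiff ℝ ∞ f) (hc : HasCompactSupport f) : ∃ C, ∀ x, ‖fderiv ℝ f x‖ ≤ C :=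
  (hc.fderiv ℝ).exists_bound_of_continuous (hf.continuous_fderiv (by simp))

theorem exists_testBound (hφ : ContDiff ℝ ∞ φ) (hc : HasCompactSupport φ) :
    ∃ A B, TestBound φ A B := by
  have hφ' : ContDiff ℝ ∞ (fderiv ℝ φ) := hφ.fderiv_right (by simp)
  obtain ⟨A, hA⟩ := exists_bound_fderiv hφ hc
  obtain ⟨B, hB⟩ := exists_bound_fderiv hφ' (hc.fderiv ℝ)
  have hlip : ∀ x y, ‖fderiv ℝ φ x - fderiv ℝ φ y‖ ≤ B * ‖x - y‖ := fun x y =>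
    convex_univ.norm_image_sub_le_of_norm_fderiv_le (𝕜 := ℝ) (f := fderiv ℝ φ)
      (fun z _ => hφ'.differentiable (by simp) z) (fun z _ => hB z) (mem_univ y) (mem_univ x)
  exact ⟨A, B, {
    smooth := hφ
    compactSupport := hc
    nonneg := (norm_nonneg _).trans (hB 0)
    fderiv_bound := hA
    fderiv_lip := hlip }⟩

theorem TestBound.nonneg_left (hφ : TestBound φ A B) : 0 ≤ A :=
  (norm_nonneg _).trans (hφ.fderiv_bound 0)

theorem TestBound.taylor (hφ : TestBound φ A B) (x w : Plane) :
    |φ (x + w) - φ x - fderiv ℝ φ x w| ≤ B * ‖w‖ ^ 2 := by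
  have := (convex_closedBall x ‖w‖).norm_image_sub_le_of_norm_hasFDerivWithin_le' (𝕜 := ℝ)
    (f := φ) (φ := fderiv ℝ φ x) (C := B * ‖w‖) (x := x) (y := x + w)
    (fun z _ => (hφ.smooth.differentiable (by simp) z).hasFDerivAt.hasFDerivWithinAt)
    (fun z hz => (hφ.fderiv_lip z x).trans (mul_le_mul_of_nonneg_left
      (by simpa [dist_eq_norm] using hz) hφ.nonneg))
    (Metric.mem_closedBall_self (norm_nonneg _)) (by simp)
  rw [add_sub_cancel_left, Real.norm_eq_abs] at this
  exact this.trans_eq (by ring)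

/-- The chain rule, with Jacobian bounded by $1+hL$ and Lipschitz with constant $hL$. The sum of the
two new bounds is at most $(A+B)(1+hL)^2$, which lets the estimate be iterated. -/
theorem TestBound.comp_euler_step (hφ : TestBound φ A B) (hu : RegField u L) {h : ℝ} (hh : 0 ≤ h)
    (t : ℝ) : TestBound (fun x => φ (x + h • u t x)) (A * (1 + h * L))
      (B * (1 + h * L) ^ 2 + A * (h * L)) := by
  have hL : (0 : ℝ) ≤ L := L.2
  have hA := hφ.nonneg_left
  have hB := hφ.nonneg
  have hS : ContDiff ℝ ∞ fun x => x + h • u t x := contDiff_id.add ((hu.smooth t).const_smul h)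
  have hd : ∀ x, fderiv ℝ (fun x => φ (x + h • u t x)) x
      = (fderiv ℝ φ (x + h • u t x)).comp (ContinuousLinearMap.id ℝ Plane + h • fderiv ℝ (u t) x) := by
    intro x
    have h1 : HasFDerivAt (fun x => x + h • u t x)
        (ContinuousLinearMap.id ℝ Plane + h • fderiv ℝ (u t) x) x :=
      (hasFDerivAt_id x).add
        ((((hu.smooth t).differentiable (by simp)) x).hasFDerivAt.const_smul h)
    exact ((hφ.smooth.differentiable (by simp) _).hasFDerivAt.comp x h1).fderiv
  have hS1 : ∀ x, ‖ContinuousLinearMap.id ℝ Plane + h • fderiv ℝ (u t) x‖ ≤ 1 + h * L := by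
    intro x
    refine (norm_add_le _ _).trans (add_le_add ContinuousLinearMap.norm_id_le ?_)
    rw [norm_smul, Real.norm_of_nonneg hh]
    exact mul_le_mul_of_nonneg_left (hu.fderiv_bound t x) hh
  have hS2 : ∀ x y, ‖(x + h • u t x) - (y + h • u t y)‖ ≤ (1 + h * L) * ‖x - y‖ := by
    intro x y
    calc ‖(x + h • u t x) - (y + h • u t y)‖ = ‖(x - y) + h • (u t x - u t y)‖ := by
          congr 1; rw [smul_sub]; abel
      _ ≤ ‖x - y‖ + h * (L * ‖x - y‖) := by
          refine (norm_add_le _ _).trans (add_le_add le_rfl ?_)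
          rw [norm_smul, Real.norm_of_nonneg hh]
          exact mul_le_mul_of_nonneg_left (hu.norm_sub_le t x y) hh
      _ = _ := by ring
  refine ⟨hφ.smooth.comp hS, ?_, by positivity, fun x => ?_, fun x y => ?_⟩
  · obtain ⟨R, hR⟩ := hφ.compactSupport.isCompact.isBounded.subset_closedBall 0
    refine HasCompactSupport.intro (isCompact_closedBall 0 (R + h * L)) fun x hx => ?_
    by_contra hne
    apply hx
    have h1 := hR (subset_tsupport _ (Function.mem_support.2 hne))
    rw [mem_closedBall_zero_iff] at h1 ⊢
    have h2 : ‖h • u t x‖ ≤ h * L := by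
      rw [norm_smul, Real.norm_of_nonneg hh]
      exact mul_le_mul_of_nonneg_left (hu.bound t x) hh
    have h3 := norm_sub_le (x + h • u t x) (h • u t x)
    rw [add_sub_cancel_right] at h3
    linarith
  · rw [hd]
    exact (ContinuousLinearMap.opNorm_comp_le _ _).trans
      (mul_le_mul (hφ.fderiv_bound _) (hS1 x) (norm_nonneg _) hA)
  · rw [hd, hd]
    set P := fderiv ℝ φ (x + h • u t x)
    set Q := fderiv ℝ φ (y + h • u t y)
    set J := ContinuousLinearMap.id ℝ Plane + h • fderiv ℝ (u t) x with hJ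
    set J' := ContinuousLinearMap.id ℝ Plane + h • fderiv ℝ (u t) y with hJ'
    have e : P.comp J - Q.comp J' = (P - Q).comp J + Q.comp (J - J') := by
      rw [ContinuousLinearMap.sub_comp, ContinuousLinearMap.comp_sub]; abel
    have hJJ : ‖J - J'‖ ≤ h * (L * ‖x - y‖) := by
      have : J - J' = h • (fderiv ℝ (u t) x - fderiv ℝ (u t) y) := by
        rw [hJ, hJ', smul_sub]; abel
      rw [this, norm_smul, Real.norm_of_nonneg hh]
      exact mul_le_mul_of_nonneg_left (hu.fderiv_lip t x y) hh
    have hPQ : ‖P - Q‖ ≤ B * ((1 + h * L) * ‖x - y‖) :=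
      (hφ.fderiv_lip _ _).trans (mul_le_mul_of_nonneg_left (hS2 x y) hB)
    rw [e]
    calc ‖(P - Q).comp J + Q.comp (J - J')‖ ≤ ‖P - Q‖ * ‖J‖ + ‖Q‖ * ‖J - J'‖ :=
          (norm_add_le _ _).trans (add_le_add (ContinuousLinearMap.opNorm_comp_le _ _)
            (ContinuousLinearMap.opNorm_comp_le _ _))
      _ ≤ B * ((1 + h * L) * ‖x - y‖) * (1 + h * L) + A * (h * (L * ‖x - y‖)) := by
          gcongr
          · exact hS1 x
          · exact hφ.fderiv_bound _
      _ = _ := by ring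

theorem TestBound.abs_apply_sub_le (hφ : TestBound φ A B) (hu : RegField u L) (t : ℝ)
    (x y : Plane) :
    ‖fderiv ℝ φ x (u t x) - fderiv ℝ φ y (u t y)‖ ≤ (A + B) * L * ‖x - y‖ := by
  have hA := hφ.nonneg_left
  have hB := hφ.nonneg
  calc ‖fderiv ℝ φ x (u t x) - fderiv ℝ φ y (u t y)‖
      = ‖fderiv ℝ φ x (u t x - u t y) + (fderiv ℝ φ x - fderiv ℝ φ y) (u t y)‖ := by
        congr 1; rw [map_sub, sub_apply]; abel
    _ ≤ A * (L * ‖x - y‖) + (B * ‖x - y‖) * L := by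
        refine (norm_add_le _ _).trans (add_le_add ?_ ?_)
        · exact (ContinuousLinearMap.le_opNorm _ _).trans
            (mul_le_mul (hφ.fderiv_bound x) (hu.norm_sub_le t x y) (norm_nonneg _) hA)
        · exact (ContinuousLinearMap.le_opNorm _ _).trans
            (mul_le_mul (hφ.fderiv_lip x y) (hu.bound t y) (norm_nonneg _) (by positivity))
    _ = _ := by ring

/-- The error of one explicit Euler step, tested against a smooth function. -/
theorem IsLinearSolution.abs_euler_step_le (hθ : IsLinearSolution u θ T M) (hu : RegField u L)
    (hφ : TestBound φ A B) {t h : ℝ} (ht : 0 ≤ t) (hh : 0 ≤ h) (hT : t + h ≤ T) :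
    |sintegral (θ (t + h)) φ - sintegral (θ t) (fun x => φ (x + h • u t x))|
      ≤ M * (L + 2 * L ^ 2) * (A + B) * h ^ 2 := by
  have hA := hφ.nonneg_left
  have hB := hφ.nonneg
  have hL : (0 : ℝ) ≤ L := L.2
  have htm : t ∈ Icc 0 T := ⟨ht, by linarith⟩
  have hthm : t + h ∈ Icc 0 T := ⟨by linarith, hT⟩
  have hM : 0 ≤ M := measureReal_nonneg.trans (hθ.bound t htm)
  have hu' : ∀ r ∈ Icc 0 T, ∀ x, ‖u r x‖ ≤ L := fun r _ x => hu.bound r x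
  set I : ℝ → ℝ := fun r => sintegral (θ r) fun x => fderiv ℝ φ x (u r x) with hI
  have hcont : ∀ r, Continuous fun x => fderiv ℝ φ x (u r x) := fun r =>
    (hφ.smooth.continuous_fderiv (by simp)).clm_apply (hu.smooth r).continuous
  have hbd : ∀ r x, ‖fderiv ℝ φ x (u r x)‖ ≤ A * L := fun r x =>
    (ContinuousLinearMap.le_opNorm _ _).trans
      (mul_le_mul (hφ.fderiv_bound x) (hu.bound r x) (norm_nonneg _) hA)
  have hint : ∀ r (μ : SignedMeasure Plane),
      Integrable (fun x => fderiv ℝ φ x (u r x)) μ.totalVariation := fun r μ =>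
    integrable_of_continuous_bounded (hcont r) (hbd r)
  -- The integrand varies in time through the field, which is Lipschitz, and through the measure.
  -- For the latter the equation is used again, with test function $\nabla\varphi\cdot u(t)$.
  have hIlip : ∀ r ∈ Icc t (t + h), |I r - I t| ≤ (A * L + (A + B) * L * L) * M * h := by
    intro r hr
    have hrm : r ∈ Icc 0 T := ⟨ht.trans hr.1, hr.2.trans hT⟩
    have hrt : |r - t| ≤ h := by rw [abs_of_nonneg (by linarith [hr.1])]; linarith [hr.2]
    have h1 : |I r - sintegral (θ r) fun x => fderiv ℝ φ x (u t x)| ≤ A * (L * h) * M := by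
      rw [hI, ← sintegral_sub (hint r _) (hint t _), ← Real.norm_eq_abs]
      refine norm_sintegral_le (by positivity) (fun x => ?_) (hθ.bound r hrm)
      change ‖fderiv ℝ φ x (u r x) - fderiv ℝ φ x (u t x)‖ ≤ _
      rw [← map_sub]
      exact (ContinuousLinearMap.le_opNorm _ _).trans (mul_le_mul (hφ.fderiv_bound x)
        ((hu.time_lip r t x).trans (mul_le_mul_of_nonneg_left hrt hL)) (norm_nonneg _) hA)
    have h2 : |(sintegral (θ r) fun x => fderiv ℝ φ x (u t x)) - I t|
        ≤ (A + B) * L * L * M * |r - t| := by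
      have hsm : ContDiff ℝ ∞ fun x => fderiv ℝ φ x (u t x) :=
        (hφ.smooth.fderiv_right (m := ∞) (by simp)).clm_apply (hu.smooth t)
      have hcs : HasCompactSupport fun x => fderiv ℝ φ x (u t x) :=
        (hφ.compactSupport.fderiv ℝ).mono fun x hx => by
          rw [Function.mem_support] at hx ⊢
          intro h0
          apply hx
          rw [h0]
          rfl
      refine hθ.abs_sub_le hu' hsm hcs (fun x => ?_) htm hrm
      exact norm_fderiv_le_of_lipschitz (C := ⟨(A + B) * L, by positivity⟩) ℝ
        (LipschitzWith.of_dist_le_mul fun y z => by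
          rw [dist_eq_norm, dist_eq_norm]
          exact hφ.abs_apply_sub_le hu t y z)
    calc |I r - I t| ≤ _ := _root_.abs_sub_le _ (sintegral (θ r) fun x => fderiv ℝ φ x (u t x)) _
      _ ≤ A * (L * h) * M + (A + B) * L * L * M * h :=
        add_le_add h1 (h2.trans (mul_le_mul_of_nonneg_left hrt (by positivity)))
      _ = _ := by ring
  have hfirst : |sintegral (θ (t + h)) φ - sintegral (θ t) φ - h * I t|
      ≤ (A * L + (A + B) * L * L) * M * h * h := by
    rw [hθ.weak_eq φ hφ.smooth hφ.compactSupport t htm _ hthm]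
    have e : h * I t = ∫ _ in t..(t + h), I t := by simp
    rw [e, ← intervalIntegral.integral_sub
      (hθ.integrable φ hφ.smooth hφ.compactSupport t htm _ hthm) intervalIntegrable_const,
      ← Real.norm_eq_abs]
    have := intervalIntegral.norm_integral_le_of_norm_le_const (a := t) (b := t + h)
      (f := fun r => I r - I t) (C := (A * L + (A + B) * L * L) * M * h) fun r hr => by
        rw [uIoc_of_le (by linarith)] at hr
        exact hIlip r ⟨hr.1.le, hr.2⟩
    rwa [add_sub_cancel_left, abs_of_nonneg hh] at this
  have hφb : ∃ C, ∀ x, ‖φ x‖ ≤ C := hφ.compactSupport.exists_bound_of_continuous hφ.smooth.continuous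
  obtain ⟨C, hC⟩ := hφb
  have hi1 : Integrable φ (θ t).totalVariation :=
    integrable_of_continuous_bounded hφ.smooth.continuous hC
  have hi2 : Integrable (fun x => φ (x + h • u t x)) (θ t).totalVariation :=
    integrable_of_continuous_bounded (hφ.smooth.continuous.comp
      (continuous_id.add ((hu.smooth t).continuous.const_smul h))) fun x => hC _
  -- Taylor expansion of the test function at the frozen measure `θ t` gives the same first order
  -- term $hI(t)$, which then cancels.
  have hsecond : |sintegral (θ t) (fun x => φ (x + h • u t x)) - sintegral (θ t) φ - h * I t|
      ≤ B * (h * L) ^ 2 * M := by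
    have e : h * I t = sintegral (θ t) fun x => h • fderiv ℝ φ x (u t x) := by
      rw [sintegral_smul]; rfl
    have hi3 : Integrable (fun x => φ (x + h • u t x) - φ x) (θ t).totalVariation := hi2.sub hi1
    have hi4 : Integrable (fun x => h • fderiv ℝ φ x (u t x)) (θ t).totalVariation :=
      (hint t _).smul h
    rw [e, ← sintegral_sub hi2 hi1, ← sintegral_sub hi3 hi4, ← Real.norm_eq_abs]
    refine norm_sintegral_le (by positivity) (fun x => ?_) (hθ.bound t htm)
    have h1 := hφ.taylor x (h • u t x)
    rw [map_smul] at h1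
    refine h1.trans (mul_le_mul_of_nonneg_left ?_ hB)
    rw [norm_smul, Real.norm_of_nonneg hh]
    gcongr
    exact hu.bound t x
  calc |sintegral (θ (t + h)) φ - sintegral (θ t) (fun x => φ (x + h • u t x))|
      = |(sintegral (θ (t + h)) φ - sintegral (θ t) φ - h * I t)
        - (sintegral (θ t) (fun x => φ (x + h • u t x)) - sintegral (θ t) φ - h * I t)| := by
        congr 1; ring
    _ ≤ (A * L + (A + B) * L * L) * M * h * h + B * (h * L) ^ 2 * M :=
        (abs_sub _ _).trans (add_le_add hfirst hsecond)
    _ = M * (A * L + (A + 2 * B) * L ^ 2) * h ^ 2 := by ring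
    _ ≤ M * (L * (A + B) + (2 * A + 2 * B) * L ^ 2) * h ^ 2 := by
        refine mul_le_mul_of_nonneg_right (mul_le_mul_of_nonneg_left ?_ hM) (sq_nonneg h)
        linarith [mul_nonneg hL hB, mul_nonneg hA (sq_nonneg (L : ℝ))]
    _ = _ := by ring

/-- The last step is moved from the solution to the test function; the induction hypothesis is then
applied to the new test function, hence the generalization over `φ`, `A` and `B`. -/
theorem IsLinearSolution.abs_euler_le (hθ : IsLinearSolution u θ T M) (hu : RegField u L)
    {h : ℝ} (hh : 0 ≤ h) (n : ℕ) (hT : n * h ≤ T) {φ : Plane → ℝ} {A B : ℝ}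
    (hφ : TestBound φ A B) :
    |sintegral (θ (n * h)) φ - sintegral (θ 0) (fun x => φ (euler u h n x))|
      ≤ n * (M * (L + 2 * L ^ 2) * (A + B)) * h ^ 2 * (1 + h * L) ^ (2 * n) := by
  induction n generalizing φ A B with
  | zero => simp [euler]
  | succ n ih =>
    have hA := hφ.nonneg_left
    have hB := hφ.nonneg
    have hL : (0 : ℝ) ≤ L := L.2
    have e : ((n + 1 : ℕ) : ℝ) * h = n * h + h := by push_cast; ring
    rw [e] at hT ⊢
    have hnh : 0 ≤ (n : ℝ) * h := by positivity
    have hM : 0 ≤ M := measureReal_nonneg.trans (hθ.bound 0 ⟨le_rfl, by linarith⟩)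
    have h1 := hθ.abs_euler_step_le hu hφ hnh hh hT
    have h2 := ih (by linarith) (hφ.comp_euler_step hu hh (n * h))
    have hq : A * (1 + h * L) + (B * (1 + h * L) ^ 2 + A * (h * L))
        ≤ (A + B) * (1 + h * L) ^ 2 := by
      have : 0 ≤ A * (h * L) ^ 2 := by positivity
      linarith [show (A + B) * (1 + h * L) ^ 2 - (A * (1 + h * L)
        + (B * (1 + h * L) ^ 2 + A * (h * L))) = A * (h * L) ^ 2 by ring]
    have h3 : (1 : ℝ) ≤ (1 + h * L) ^ (2 * (n + 1)) :=
      one_le_pow₀ (by nlinarith [mul_nonneg hh hL])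
    calc _ ≤ _ := _root_.abs_sub_le _ (sintegral (θ (n * h)) fun x => φ (x + h • u (n * h) x)) _
      _ ≤ M * (L + 2 * L ^ 2) * (A + B) * h ^ 2 * (1 + h * L) ^ (2 * (n + 1))
          + n * (M * (L + 2 * L ^ 2) * ((A + B) * (1 + h * L) ^ 2)) * h ^ 2
            * (1 + h * L) ^ (2 * n) := by
          refine add_le_add (h1.trans (le_mul_of_one_le_right (by positivity) h3)) (h2.trans ?_)
          gcongr
      _ = _ := by push_cast; ring

/-- A solution of the linear continuity equation with a regular field is transported by the
flow. -/
theorem IsLinearSolution.eq_push (hθ : IsLinearSolution u θ T M) (hu : RegField u L)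
    (hX : IsFlow u X) {t : ℝ} (ht : t ∈ Icc 0 T) : θ t = push (X t) (θ 0) := by
  have hM : 0 ≤ M := measureReal_nonneg.trans (hθ.bound t ht)
  refine signedMeasure_ext_of_contDiff fun φ hφ hc => ?_
  rw [sintegral_push (hX.measurableEmbedding hu ht.1)]
  obtain ⟨A, B, hAB⟩ := exists_testBound hφ hc
  obtain ⟨C, hC⟩ := hc.exists_bound_of_continuous hφ.continuous
  have hlim := tendsto_sintegral_of_bounded (θ 0) (C := C)
    (f := fun N x => φ (euler u (t / ((N + 1 : ℕ) : ℝ)) (N + 1) x)) (g := fun x => φ (X t x))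
    (fun N => hφ.continuous.comp (hu.continuous_euler _ _)) (fun N x => hC _)
    (fun x => (hφ.continuous.tendsto _).comp (hX.tendsto_euler hu ht.1 x))
  -- The integrals of `φ` along the Euler maps converge to the integral along the flow; by the
  -- duality estimate they also converge to the integral against `θ t`.
  refine tendsto_nhds_unique ?_ hlim
  rw [tendsto_iff_norm_sub_tendsto_zero]
  have hA := hAB.nonneg_left
  have hB := hAB.nonneg
  refine squeeze_zero (fun _ => norm_nonneg _) (fun N => ?_)
    (tendsto_euler_error (M * (L + 2 * L ^ 2) * (A + B)) L t L.2 ht.1 (by positivity) 2)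
  have e : ((N + 1 : ℕ) : ℝ) * (t / ((N + 1 : ℕ) : ℝ)) = t := mul_div_cancel₀ t (by positivity)
  have ht0 := ht.1
  have := hθ.abs_euler_le hu (h := t / ((N + 1 : ℕ) : ℝ)) (by positivity) (N + 1)
    (by rw [e]; exact ht.2) hAB
  rw [e] at this
  rw [norm_sub_rev]
  exact this

/-- A solution is the image of its initial condition under the flow of a regular field that agrees
on `[0, T]` with its velocity field. -/
theorem IsSolution.exists_flow {k : Plane → Plane} (hk : SmoothBdd k) {θ₀ : SignedMeasure Plane}
    (h : IsSolution k θ₀ θ) (hT : 0 ≤ T) :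
    ∃ (u : ℝ → Plane → Plane) (L : ℝ≥0) (X : ℝ → Plane → Plane), RegField u L ∧ IsFlow u X ∧
      (∀ t, ∃ s ∈ Icc 0 T, u t = velocity k (θ s)) ∧ (∀ t ∈ Icc 0 T, u t = velocity k (θ t)) ∧
      ∀ t ∈ Icc 0 T, θ t = push (X t) θ₀ := by
  obtain ⟨M, hM⟩ := h.locally_bounded T
  have hM' : ∀ t ∈ Icc 0 T, (θ t).totalVariation.real univ ≤ M := fun t ht =>
    ENNReal.toReal_le_of_le_ofReal M.2 (by simpa using hM t ht)
  obtain ⟨L, hL⟩ := h.exists_regField hk hT hM'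
  obtain ⟨X, hX⟩ := hL.exists_isFlow
  have hag : ∀ t ∈ Icc 0 T, velocity k (θ (projIcc 0 T hT t)) = velocity k (θ t) := by
    intro t ht
    rw [projIcc_of_mem hT ht]
  -- The field is frozen outside $[0,T]$, so each of its time slices is the velocity of some `θ s`.
  -- Zero divergence thus holds at all times.
  refine ⟨_, L, X, hL, hX, fun t => ⟨_, (projIcc 0 T hT t).2, rfl⟩, hag, fun t ht => ?_⟩
  rw [← h.zero]
  exact ((h.isLinearSolution hM').congr fun t ht => (hag t ht).symm).eq_push hL hX ht

end Duality

/-! ### Stability in the Wasserstein distance, and uniqueness -/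

section Stability

/-- The bounded distance `min 1 |x - y|`. -/
@[irreducible]
def bdist (x y : Plane) : ℝ := min 1 ‖x - y‖

theorem bdist_eq (x y : Plane) : bdist x y = min 1 ‖x - y‖ := by
  rw [bdist]

theorem bdist_nonneg (x y : Plane) : 0 ≤ bdist x y := by
  rw [bdist_eq]
  exact le_min zero_le_one (norm_nonneg _)

theorem norm_bdist_le (x y : Plane) : ‖bdist x y‖ ≤ 1 := by
  rw [Real.norm_of_nonneg (bdist_nonneg x y), bdist_eq]
  exact min_le_left _ _

theorem continuous_bdist_comp {α : Type*} [TopologicalSpace α] {f g : α → Plane}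
    (hf : Continuous f) (hg : Continuous g) : Continuous fun a => bdist (f a) (g a) := by
  simp only [bdist_eq]
  exact continuous_const.min (hf.sub hg).norm

theorem continuous_bdist : Continuous fun p : Plane × Plane => bdist p.1 p.2 :=
  continuous_bdist_comp continuous_fst continuous_snd

theorem min_one_norm_add_le {a b : ℝ} (ha : 0 ≤ a) (hb : 0 ≤ b) :
    min 1 (a + b) ≤ min 1 a + min 1 b := by
  rcases le_total 1 a with h1 | h1 <;> rcases le_total 1 b with h2 | h2 <;>
    simp only [min_eq_left, min_eq_right, h1, h2] <;>
    first
    | exact (min_le_left _ _).trans (by linarith)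
    | exact (min_le_right _ _).trans (by linarith)

/-- The integral form of Grönwall's inequality. -/
theorem le_mul_exp_of_le_add_integral {h : ℝ → ℝ} (hc : Continuous h) (h0 : ∀ t, 0 ≤ h t)
    {K T : ℝ} (hK : 0 ≤ K) (hle : ∀ t ∈ Icc 0 T, h t ≤ h 0 + K * ∫ s in (0 : ℝ)..t, h s) :
    ∀ t ∈ Icc 0 T, h t ≤ h 0 * Real.exp (K * t) := by
  intro t ht
  -- The function `h` is merely continuous, so the differential inequality is used for its integral
  -- majorant.
  set g : ℝ → ℝ := fun t => h 0 + K * ∫ s in (0 : ℝ)..t, h s with hg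
  have hd : ∀ t, HasDerivAt g (K * h t) t := fun t =>
    ((hc.integral_hasStrictDerivAt 0 t).hasDerivAt.const_mul K).const_add (h 0)
  have hgr := norm_le_gronwallBound_of_norm_deriv_right_le (f := g) (f' := fun t => K * h t)
    (δ := h 0) (K := K) (ε := 0) (a := 0) (b := T)
    (fun s _ => (hd s).continuousAt.continuousWithinAt) (fun s _ => (hd s).hasDerivWithinAt)
    (by simp [hg, abs_of_nonneg (h0 0)])
    (fun s hs => by
      rw [Real.norm_of_nonneg (mul_nonneg hK (h0 s)), add_zero]
      exact mul_le_mul_of_nonneg_left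
        ((hle s (Ico_subset_Icc_self hs)).trans (le_abs_self _)) hK) t ht
  rw [gronwallBound_ε0, sub_zero] at hgr
  exact (hle t ht).trans ((le_abs_self _).trans hgr)

variable {k : Plane → Plane} {θ₀₁ θ₀₂ : SignedMeasure Plane} {X₁ X₂ : ℝ → Plane → Plane}
  {π₁ π₂ : Measure (Plane × Plane)}

theorem isFiniteMeasure_of_map {α : Type*} [MeasurableSpace α] {π : Measure α} {f : α → Plane}
    (hf : Measurable f) {μ : Measure Plane} [IsFiniteMeasure μ] (h : π.map f = μ) :
    IsFiniteMeasure π := by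
  refine ⟨?_⟩
  have := measure_lt_top μ univ
  rwa [← h, Measure.map_apply hf MeasurableSet.univ, preimage_univ] at this

theorem sintegral_eq_of_map {θ : SignedMeasure Plane} {f : Plane × Plane → Plane}
    (hf : Measurable f) (h₁ : π₁.map f = θ.toJordanDecomposition.posPart)
    (h₂ : π₂.map f = θ.toJordanDecomposition.negPart) {g : Plane → Plane} (hg : Continuous g) :
    sintegral θ g = (∫ p, g (f p) ∂π₁) - ∫ p, g (f p) ∂π₂ := by
  rw [sintegral, ← h₁, ← h₂, integral_map hf.aemeasurable hg.aestronglyMeasurable,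
    integral_map hf.aemeasurable hg.aestronglyMeasurable]

/-- The difference of the velocities along two flows, in terms of a coupling of the initial
conditions. -/
theorem norm_velocity_push_sub_le (hk : SmoothBdd k) {Φ₁ Φ₂ : Plane → Plane}
    (hΦ₁ : MeasurableEmbedding Φ₁) (hΦ₁c : Continuous Φ₁) (hΦ₂ : MeasurableEmbedding Φ₂)
    (hΦ₂c : Continuous Φ₂)
    (h₁f : π₁.map Prod.fst = θ₀₁.toJordanDecomposition.posPart)
    (h₁s : π₁.map Prod.snd = θ₀₂.toJordanDecomposition.posPart)
    (h₂f : π₂.map Prod.fst = θ₀₁.toJordanDecomposition.negPart)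
    (h₂s : π₂.map Prod.snd = θ₀₂.toJordanDecomposition.negPart) (x y : Plane) :
    ‖velocity k (push Φ₁ θ₀₁) x - velocity k (push Φ₂ θ₀₂) y‖
      ≤ (kernelConst k).toNNReal * ((π₁ + π₂).real univ * bdist x y
        + ∫ p, bdist (Φ₁ p.1) (Φ₂ p.2) ∂(π₁ + π₂)) := by
  have : IsFiniteMeasure π₁ := isFiniteMeasure_of_map measurable_fst h₁f
  have : IsFiniteMeasure π₂ := isFiniteMeasure_of_map measurable_fst h₂f
  obtain ⟨K, hK⟩ := hk.exists_bound
  set c := (kernelConst k).toNNReal with hc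
  have hkc := hk.smooth.continuous
  have e1 : velocity k (push Φ₁ θ₀₁) x
      = (∫ p, k (x - Φ₁ p.1) ∂π₁) - ∫ p, k (x - Φ₁ p.1) ∂π₂ := by
    rw [velocity, sintegral_push hΦ₁]
    exact sintegral_eq_of_map (g := fun y => k (x - Φ₁ y)) measurable_fst h₁f h₂f
      (hkc.comp (continuous_const.sub hΦ₁c))
  have e2 : velocity k (push Φ₂ θ₀₂) y
      = (∫ p, k (y - Φ₂ p.2) ∂π₁) - ∫ p, k (y - Φ₂ p.2) ∂π₂ := by
    rw [velocity, sintegral_push hΦ₂]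
    exact sintegral_eq_of_map (g := fun z => k (y - Φ₂ z)) measurable_snd h₁s h₂s
      (hkc.comp (continuous_const.sub hΦ₂c))
  have hi1 : ∀ (ν : Measure (Plane × Plane)) [IsFiniteMeasure ν],
      Integrable (fun p => k (x - Φ₁ p.1)) ν := fun ν _ =>
    integrable_of_continuous_bounded (hkc.comp (continuous_const.sub (hΦ₁c.comp continuous_fst)))
      fun p => hK _
  have hi2 : ∀ (ν : Measure (Plane × Plane)) [IsFiniteMeasure ν],
      Integrable (fun p => k (y - Φ₂ p.2)) ν := fun ν _ =>
    integrable_of_continuous_bounded (hkc.comp (continuous_const.sub (hΦ₂c.comp continuous_snd)))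
      fun p => hK _
  have hi3 : ∀ (ν : Measure (Plane × Plane)) [IsFiniteMeasure ν],
      Integrable (fun p => bdist (Φ₁ p.1) (Φ₂ p.2)) ν := fun ν _ =>
    integrable_of_continuous_bounded
      (continuous_bdist_comp (hΦ₁c.comp continuous_fst) (hΦ₂c.comp continuous_snd))
      fun p => norm_bdist_le _ _
  have hpt : ∀ p : Plane × Plane, ‖k (x - Φ₁ p.1) - k (y - Φ₂ p.2)‖
      ≤ c * (bdist x y + bdist (Φ₁ p.1) (Φ₂ p.2)) := by
    intro p
    refine (norm_sub_le_kernelConst hk _ _).trans (mul_le_mul_of_nonneg_left ?_ c.coe_nonneg)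
    have hn : ‖x - Φ₁ p.1 - (y - Φ₂ p.2)‖ ≤ ‖x - y‖ + ‖Φ₁ p.1 - Φ₂ p.2‖ := by
      rw [show x - Φ₁ p.1 - (y - Φ₂ p.2) = (x - y) - (Φ₁ p.1 - Φ₂ p.2) by abel]
      exact norm_sub_le _ _
    rw [bdist_eq x, bdist_eq (Φ₁ p.1)]
    exact (min_le_min_left 1 hn).trans (min_one_norm_add_le (norm_nonneg _) (norm_nonneg _))
  have hν : ∀ (ν : Measure (Plane × Plane)) [IsFiniteMeasure ν],
      ‖∫ p, (k (x - Φ₁ p.1) - k (y - Φ₂ p.2)) ∂ν‖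
        ≤ c * (ν.real univ * bdist x y + ∫ p, bdist (Φ₁ p.1) (Φ₂ p.2) ∂ν) := by
    intro ν _
    refine (norm_integral_le_of_norm_le (((integrable_const (bdist x y)).add (hi3 ν)).const_mul
      (c : ℝ)) (Eventually.of_forall hpt)).trans_eq ?_
    rw [integral_const_mul]
    congr 1
    rw [← smul_eq_mul, ← integral_const (bdist x y)]
    exact integral_add (integrable_const _) (hi3 ν)
  rw [e1, e2]
  -- Both velocities are integrals over the same couplings, so the kernels can be subtracted
  -- pointwise.
  calc ‖(∫ p, k (x - Φ₁ p.1) ∂π₁) - (∫ p, k (x - Φ₁ p.1) ∂π₂)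
        - ((∫ p, k (y - Φ₂ p.2) ∂π₁) - ∫ p, k (y - Φ₂ p.2) ∂π₂)‖
      = ‖(∫ p, (k (x - Φ₁ p.1) - k (y - Φ₂ p.2)) ∂π₁)
        - ∫ p, (k (x - Φ₁ p.1) - k (y - Φ₂ p.2)) ∂π₂‖ := by
        rw [integral_sub (hi1 π₁) (hi2 π₁), integral_sub (hi1 π₂) (hi2 π₂)]
        congr 1
        abel
    _ ≤ _ := (norm_sub_le _ _).trans (add_le_add (hν π₁) (hν π₂))
    _ = _ := by
        rw [integral_add_measure (hi3 π₁) (hi3 π₂), measureReal_add_apply]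
        ring

/-- Two solutions and a coupling of their initial conditions: the transported coupling remains
close to the diagonal. -/
theorem exists_push_bdist_le (hk : SmoothBdd k) {θ₁ θ₂ : ℝ → SignedMeasure Plane}
    (h₁ : IsSolution k θ₀₁ θ₁) (h₂ : IsSolution k θ₀₂ θ₂) {T M : ℝ}
    (h₁f : π₁.map Prod.fst = θ₀₁.toJordanDecomposition.posPart)
    (h₁s : π₁.map Prod.snd = θ₀₂.toJordanDecomposition.posPart)
    (h₂f : π₂.map Prod.fst = θ₀₁.toJordanDecomposition.negPart)
    (h₂s : π₂.map Prod.snd = θ₀₂.toJordanDecomposition.negPart)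
    (hM : (π₁ + π₂).real univ ≤ M) {t : ℝ} (ht : t ∈ Icc 0 T) :
    ∃ Φ₁ Φ₂ : Plane → Plane, MeasurableEmbedding Φ₁ ∧ MeasurableEmbedding Φ₂ ∧
      θ₁ t = push Φ₁ θ₀₁ ∧ θ₂ t = push Φ₂ θ₀₂ ∧
      ∫⁻ p, ENNReal.ofReal (bdist (Φ₁ p.1) (Φ₂ p.2)) ∂(π₁ + π₂)
        ≤ ENNReal.ofReal (Real.exp (2 * (kernelConst k).toNNReal * M * T))
          * ∫⁻ p, ENNReal.ofReal (bdist p.1 p.2) ∂(π₁ + π₂) := by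
  have hT : 0 ≤ T := ht.1.trans ht.2
  have : IsFiniteMeasure π₁ := isFiniteMeasure_of_map measurable_fst h₁f
  have : IsFiniteMeasure π₂ := isFiniteMeasure_of_map measurable_fst h₂f
  obtain ⟨u₁, L₁, X₁, hu₁, hX₁, -, hv₁, hp₁⟩ := h₁.exists_flow hk hT
  obtain ⟨u₂, L₂, X₂, hu₂, hX₂, -, hv₂, hp₂⟩ := h₂.exists_flow hk hT
  set c := (kernelConst k).toNNReal with hc
  set π := π₁ + π₂ with hπ
  set m := π.real univ with hm
  have hm0 : 0 ≤ m := measureReal_nonneg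
  have hM0 : 0 ≤ M := hm0.trans hM
  have hc0 : (0 : ℝ) ≤ c := c.2
  let d : ℝ → Plane × Plane → ℝ := fun s p => bdist (X₁ (max s 0) p.1) (X₂ (max s 0) p.2)
  have hdc : Continuous fun q : ℝ × (Plane × Plane) => d q.1 q.2 :=
    continuous_bdist_comp
      ((hX₁.continuous_max hu₁).comp (continuous_fst.prodMk (continuous_fst.comp continuous_snd)))
      ((hX₂.continuous_max hu₂).comp (continuous_fst.prodMk (continuous_snd.comp continuous_snd)))
  have hdc1 : ∀ s, Continuous (d s) := fun s => hdc.comp (Continuous.prodMk_right s)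
  have hdc2 : ∀ p, Continuous fun s => d s p := fun p => hdc.comp (Continuous.prodMk_left p)
  have hdb : ∀ s p, ‖d s p‖ ≤ 1 := fun s p => norm_bdist_le _ _
  have hd0 : ∀ s p, 0 ≤ d s p := fun s p => bdist_nonneg _ _
  have hdi : ∀ s, Integrable (d s) π := fun s => integrable_of_continuous_bounded (hdc1 s) (hdb s)
  let h : ℝ → ℝ := fun s => ∫ p, d s p ∂π
  have hh0 : ∀ s, 0 ≤ h s := fun s => integral_nonneg (hd0 s)
  have hhc : Continuous h := continuous_of_dominated (bound := fun _ => 1)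
    (fun s => (hdc1 s).aestronglyMeasurable) (fun s => Eventually.of_forall (hdb s))
    (integrable_const 1) (Eventually.of_forall hdc2)
  have hgc : ∀ p, Continuous fun s => c * (m * d s p + h s) := fun p =>
    continuous_const.mul ((continuous_const.mul (hdc2 p)).add hhc)
  -- The comparison is made for the distance of the trajectories itself; the truncation at $1$
  -- follows by subadditivity.
  have hpoint : ∀ p : Plane × Plane, ∀ s ∈ Icc 0 T,
      d s p ≤ d 0 p + ∫ r in (0 : ℝ)..s, c * (m * d r p + h r) := by
    intro p s hs
    have hnorm := image_norm_le_of_norm_deriv_right_le_deriv_boundary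
      (f := fun r => X₁ r p.1 - X₂ r p.2)
      (f' := fun r => u₁ r (X₁ r p.1) - u₂ r (X₂ r p.2)) (a := 0) (b := T)
      (B := fun s => ‖p.1 - p.2‖ + ∫ r in (0 : ℝ)..s, c * (m * d r p + h r))
      (B' := fun s => c * (m * d s p + h s))
      (fun r _ => ((hX₁.deriv r p.1).sub (hX₂.deriv r p.2)).continuousAt.continuousWithinAt)
      (fun r _ => ((hX₁.deriv r p.1).sub (hX₂.deriv r p.2)).hasDerivWithinAt)
      (by simp [hX₁.zero, hX₂.zero])
      (fun r => ((hgc p).integral_hasStrictDerivAt 0 r).hasDerivAt.const_add _)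
      (fun r hr => by
        have hr' := Ico_subset_Icc_self hr
        have key := norm_velocity_push_sub_le hk (hX₁.measurableEmbedding hu₁ hr.1)
          (hX₁.continuous_space hu₁ hr.1) (hX₂.measurableEmbedding hu₂ hr.1)
          (hX₂.continuous_space hu₂ hr.1) h₁f h₁s h₂f h₂s (X₁ r p.1) (X₂ r p.2)
        rw [← hp₁ r hr', ← hp₂ r hr', ← hv₁ r hr', ← hv₂ r hr'] at key
        simpa only [d, h, max_eq_left hr.1] using key)
      hs
    have hI0 : 0 ≤ ∫ r in (0 : ℝ)..s, c * (m * d r p + h r) :=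
      intervalIntegral.integral_nonneg hs.1 fun r _ =>
        mul_nonneg hc0 (add_nonneg (mul_nonneg hm0 (hd0 r p)) (hh0 r))
    have e : d 0 p = min 1 ‖p.1 - p.2‖ := by simp [d, bdist_eq, hX₁.zero, hX₂.zero]
    have e' : d s p = min 1 ‖X₁ s p.1 - X₂ s p.2‖ := by simp [d, bdist_eq, max_eq_left hs.1]
    rw [e, e']
    refine (min_le_min_left 1 hnorm).trans ((min_one_norm_add_le (norm_nonneg _) hI0).trans ?_)
    exact add_le_add le_rfl (min_le_right _ _)
  -- Integration over the coupling and Fubini. The distance of the particle pair and the mean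
  -- distance contribute $cm\,h$ each, whence the factor $2$.
  have hint : ∀ s ∈ Icc 0 T, h s ≤ h 0 + (2 * c * M) * ∫ r in (0 : ℝ)..s, h r := by
    intro s hs
    have hFc : Continuous fun q : ℝ × (Plane × Plane) => c * (m * d q.1 q.2 + h q.1) :=
      continuous_const.mul ((continuous_const.mul hdc).add (hhc.comp continuous_fst))
    have hhm : ∀ r, h r ≤ m := fun r => by
      have := norm_integral_le_of_norm_le_const (μ := π) (f := d r) (C := 1)
        (Eventually.of_forall (hdb r))
      rw [Real.norm_of_nonneg (hh0 r), one_mul] at this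
      exact this
    have hFb : ∀ q : ℝ × (Plane × Plane), ‖c * (m * d q.1 q.2 + h q.1)‖ ≤ c * (m * 1 + m) := by
      intro q
      rw [Real.norm_of_nonneg (mul_nonneg hc0 (add_nonneg (mul_nonneg hm0 (hd0 _ _)) (hh0 _)))]
      have h1 : d q.1 q.2 ≤ 1 := (le_abs_self _).trans (hdb _ _)
      have h2 := hhm q.1
      gcongr
    have hFi : Integrable (fun q : ℝ × (Plane × Plane) => c * (m * d q.1 q.2 + h q.1))
        ((volume.restrict (Ioc 0 s)).prod π) := integrable_of_continuous_bounded hFc hFb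
    have hswap : ∫ p, (∫ r in (0 : ℝ)..s, c * (m * d r p + h r)) ∂π
        = ∫ r in (0 : ℝ)..s, (∫ p, c * (m * d r p + h r) ∂π) := by
      simp only [intervalIntegral.integral_of_le hs.1]
      exact (integral_integral_swap hFi).symm
    have hinner : ∀ r, ∫ p, c * (m * d r p + h r) ∂π = (2 * c * m) * h r := by
      intro r
      rw [integral_const_mul, integral_add ((hdi r).const_mul m) (integrable_const _),
        integral_const_mul, integral_const, smul_eq_mul]
      change c * (m * h r + m * h r) = _
      ring
    have hIi : Integrable (fun p => ∫ r in (0 : ℝ)..s, c * (m * d r p + h r)) π := by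
      simp only [intervalIntegral.integral_of_le hs.1]
      exact hFi.integral_prod_right
    have hI0 : 0 ≤ ∫ r in (0 : ℝ)..s, h r :=
      intervalIntegral.integral_nonneg hs.1 fun r _ => hh0 r
    calc h s ≤ ∫ p, (d 0 p + ∫ r in (0 : ℝ)..s, c * (m * d r p + h r)) ∂π :=
          integral_mono (hdi s) ((hdi 0).add hIi) fun p => hpoint p s hs
      _ = h 0 + (2 * c * m) * ∫ r in (0 : ℝ)..s, h r := by
          rw [integral_add (hdi 0) hIi, hswap]
          simp only [hinner, intervalIntegral.integral_const_mul]
          rfl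
      _ ≤ _ := by gcongr
  have hfin := le_mul_exp_of_le_add_integral hhc hh0 (K := 2 * c * M) (by positivity) hint t ht
  have hexp : Real.exp (2 * c * M * t) ≤ Real.exp (2 * c * M * T) :=
    Real.exp_le_exp.2 (mul_le_mul_of_nonneg_left ht.2 (by positivity))
  have hlin : ∀ s, ∫⁻ p, ENNReal.ofReal (d s p) ∂π = ENNReal.ofReal (h s) := fun s =>
    (ofReal_integral_eq_lintegral_ofReal (hdi s) (Eventually.of_forall (hd0 s))).symm
  refine ⟨X₁ t, X₂ t, hX₁.measurableEmbedding hu₁ ht.1, hX₂.measurableEmbedding hu₂ ht.1,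
    hp₁ t ht, hp₂ t ht, ?_⟩
  have e0 := hlin 0
  have et := hlin t
  simp only [d, max_eq_left ht.1, max_self, hX₁.zero, hX₂.zero] at e0 et
  rw [e0, et, ← ENNReal.ofReal_mul (Real.exp_pos _).le]
  refine ENNReal.ofReal_le_ofReal (hfin.trans ?_)
  rw [mul_comm]
  exact mul_le_mul_of_nonneg_right hexp (hh0 0)

theorem wass_map_le {π : Measure (Plane × Plane)} {Φ₁ Φ₂ : Plane → Plane} (hΦ₁ : Measurable Φ₁)
    (hΦ₂ : Measurable Φ₂) :
    wass ((π.map Prod.fst).map Φ₁) ((π.map Prod.snd).map Φ₂)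
      ≤ ∫⁻ p, ENNReal.ofReal (bdist (Φ₁ p.1) (Φ₂ p.2)) ∂π := by
  have hm : Measurable fun p : Plane × Plane => (Φ₁ p.1, Φ₂ p.2) :=
    (hΦ₁.comp measurable_fst).prodMk (hΦ₂.comp measurable_snd)
  have h1 : (π.map fun p => (Φ₁ p.1, Φ₂ p.2)).map Prod.fst = (π.map Prod.fst).map Φ₁ := by
    rw [Measure.map_map measurable_fst hm, Measure.map_map hΦ₁ measurable_fst]
    rfl
  have h2 : (π.map fun p => (Φ₁ p.1, Φ₂ p.2)).map Prod.snd = (π.map Prod.snd).map Φ₂ := by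
    rw [Measure.map_map measurable_snd hm, Measure.map_map hΦ₂ measurable_snd]
    rfl
  have h3 : ∫⁻ z, ENNReal.ofReal (min 1 ‖z.1 - z.2‖) ∂(π.map fun p => (Φ₁ p.1, Φ₂ p.2))
      = ∫⁻ p, ENNReal.ofReal (bdist (Φ₁ p.1) (Φ₂ p.2)) ∂π := by
    simp only [← bdist_eq]
    exact lintegral_map (ENNReal.measurable_ofReal.comp continuous_bdist.measurable) hm
  rw [← h3, wass]
  exact iInf₂_le_of_le _ ⟨h1, h2⟩ le_rfl

/-- The transported couplings compete in the infimum at time `t`. Couplings of both parts are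
optimized separately; if one of the sets of couplings is empty, the right-hand side is infinite. -/
theorem signedWass_le (hk : SmoothBdd k) {θ₁ θ₂ : ℝ → SignedMeasure Plane}
    (h₁ : IsSolution k θ₀₁ θ₁) (h₂ : IsSolution k θ₀₂ θ₂) {T M : ℝ}
    (hM0 : 0 ≤ M) (hM : θ₀₁.totalVariation univ ≤ ENNReal.ofReal M) {t : ℝ} (ht : t ∈ Icc 0 T) :
    signedWass (θ₁ t) (θ₂ t) ≤ ENNReal.ofReal (Real.exp (2 * (kernelConst k).toNNReal * M * T))
      * signedWass θ₀₁ θ₀₂ := by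
  set Γ := ENNReal.ofReal (Real.exp (2 * (kernelConst k).toNNReal * M * T)) with hΓ
  have hΓ0 : Γ ≠ 0 := by simpa [hΓ] using Real.exp_pos _
  have hΓt : Γ ≠ ⊤ := ENNReal.ofReal_ne_top
  -- The constant is moved to the left so that the infima stand alone on the right.
  rw [mul_comm, ← ENNReal.div_le_iff hΓ0 hΓt]
  unfold signedWass
  conv_rhs => rw [wass, wass]
  simp only [ENNReal.iInf_add, ENNReal.add_iInf]
  refine le_iInf₂ fun π₂ hπ₂ => le_iInf₂ fun π₁ hπ₁ => ?_
  rw [ENNReal.div_le_iff hΓ0 hΓt, mul_comm]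
  -- The first marginals are the Jordan parts of `θ₀₁`, so the total mass of the couplings is its
  -- total variation.
  have hmass : (π₁ + π₂).real univ ≤ M := by
    refine ENNReal.toReal_le_of_le_ofReal hM0 (le_of_eq_of_le ?_ hM)
    rw [SignedMeasure.totalVariation, ← hπ₁.1, ← hπ₂.1]
    simp [Measure.map_apply measurable_fst MeasurableSet.univ]
  obtain ⟨Φ₁, Φ₂, hΦ₁, hΦ₂, e₁, e₂, hle⟩ := exists_push_bdist_le hk h₁ h₂ hπ₁.1 hπ₁.2 hπ₂.1 hπ₂.2
    hmass ht
  rw [lintegral_add_measure, lintegral_add_measure] at hle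
  simp only [← bdist_eq]
  refine le_trans (add_le_add ?_ ?_) hle
  · rw [e₁, e₂, (toJordanDecomposition_push hΦ₁ _).1, (toJordanDecomposition_push hΦ₂ _).1,
      ← hπ₁.1, ← hπ₁.2]
    exact wass_map_le hΦ₁.measurable hΦ₂.measurable
  · rw [e₁, e₂, (toJordanDecomposition_push hΦ₁ _).2, (toJordanDecomposition_push hΦ₂ _).2,
      ← hπ₂.1, ← hπ₂.2]
    exact wass_map_le hΦ₁.measurable hΦ₂.measurable

/-- The diagonal coupling has zero cost and keeps it, so the two flow maps agree almost everywhere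
with respect to $|\theta_0|$ and have the same images of both parts. -/
theorem IsSolution.unique (hk : SmoothBdd k) {θ₀ : SignedMeasure Plane}
    {θ θ' : ℝ → SignedMeasure Plane} (h : IsSolution k θ₀ θ) (h' : IsSolution k θ₀ θ') {t : ℝ}
    (ht : 0 ≤ t) : θ t = θ' t := by
  have hdiag : Measurable fun x : Plane => (x, x) := measurable_id.prodMk measurable_id
  have hfst : ∀ μ : Measure Plane, (μ.map fun x => (x, x)).map Prod.fst = μ := fun μ => by
    rw [Measure.map_map measurable_fst hdiag]
    exact Measure.map_id
  have hsnd : ∀ μ : Measure Plane, (μ.map fun x => (x, x)).map Prod.snd = μ := fun μ => by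
    rw [Measure.map_map measurable_snd hdiag]
    exact Measure.map_id
  obtain ⟨Φ₁, Φ₂, hΦ₁, hΦ₂, e₁, e₂, hle⟩ := exists_push_bdist_le hk h h' (T := t)
    (hfst _) (hsnd _) (hfst _) (hsnd _) le_rfl (t := t) ⟨ht, le_rfl⟩
  rw [← Measure.map_add _ _ hdiag] at hle
  set μ := θ₀.toJordanDecomposition.posPart + θ₀.toJordanDecomposition.negPart with hμ
  have hmb : Measurable fun p : Plane × Plane => ENNReal.ofReal (bdist p.1 p.2) :=
    ENNReal.measurable_ofReal.comp continuous_bdist.measurable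
  have hmΦ : Measurable fun p : Plane × Plane => (Φ₁ p.1, Φ₂ p.2) :=
    (hΦ₁.measurable.comp measurable_fst).prodMk (hΦ₂.measurable.comp measurable_snd)
  have hmb' : Measurable fun p : Plane × Plane => ENNReal.ofReal (bdist (Φ₁ p.1) (Φ₂ p.2)) :=
    hmb.comp hmΦ
  rw [lintegral_map hmb hdiag, lintegral_map hmb' hdiag] at hle
  have hz : ∫⁻ x, ENNReal.ofReal (bdist (Φ₁ x) (Φ₂ x)) ∂μ = 0 := by
    refine le_antisymm (hle.trans_eq ?_) zero_le
    simp [bdist_eq]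
  have hmd : Measurable fun x => ENNReal.ofReal (bdist (Φ₁ x) (Φ₂ x)) := hmb'.comp hdiag
  rw [lintegral_eq_zero_iff hmd] at hz
  have hae : Φ₁ =ᵐ[μ] Φ₂ := by
    filter_upwards [hz] with x hx
    have h1 : bdist (Φ₁ x) (Φ₂ x) ≤ 0 := ENNReal.ofReal_eq_zero.1 hx
    rw [bdist_eq] at h1
    have h2 : ‖Φ₁ x - Φ₂ x‖ ≤ 0 := by
      rcases min_le_iff.1 h1 with h3 | h3
      · linarith
      · exact h3
    exact sub_eq_zero.1 (norm_le_zero_iff.1 h2)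
  rw [hμ] at hae
  have hae₁ : Φ₁ =ᵐ[θ₀.toJordanDecomposition.posPart] Φ₂ := (ae_add_measure_iff.1 hae).1
  have hae₂ : Φ₁ =ᵐ[θ₀.toJordanDecomposition.negPart] Φ₂ := (ae_add_measure_iff.1 hae).2
  rw [e₁, e₂]
  refine VectorMeasure.ext fun s hs => ?_
  rw [SignedMeasure.apply_eq_posPart_real_sub_negPart_real _ hs,
    SignedMeasure.apply_eq_posPart_real_sub_negPart_real _ hs,
    (toJordanDecomposition_push hΦ₁ _).1, (toJordanDecomposition_push hΦ₂ _).1,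
    (toJordanDecomposition_push hΦ₁ _).2, (toJordanDecomposition_push hΦ₂ _).2,
    Measure.map_congr hae₁, Measure.map_congr hae₂]

end Stability

/-! ### Transport of densities -/

section Density

/-- The image of a density under an invertible measure preserving map. -/
theorem push_withDensity {Φ : Plane → Plane} (hΦ : MeasurableEmbedding Φ)
    (hp : MeasurePreserving Φ volume volume) {f₀ : Plane → ℝ} (h1 : MemLp f₀ 1 volume)
    (ht : MemLp f₀ ⊤ volume) : ∃ f : Plane → ℝ, MemLp f 1 volume ∧ MemLp f ⊤ volume ∧
      push Φ (volume.withDensityᵥ f₀) = volume.withDensityᵥ f ∧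
      ∀ p : ℝ≥0∞, eLpNorm f p volume = eLpNorm f₀ p volume := by
  -- The density is $f_0\circ\Phi^{-1}$ on the range of `Φ` and $0$ elsewhere. Lebesgue measure is
  -- its own image under `Φ`, so every norm of `f` is the norm of $f\circ\Phi=f_0$.
  set f : Plane → ℝ := Function.extend Φ f₀ 0 with hf
  have hcomp : f ∘ Φ = f₀ := Function.extend_comp hΦ.injective f₀ 0
  have hnorm : ∀ p : ℝ≥0∞, eLpNorm f p volume = eLpNorm f₀ p volume := by
    intro p
    conv_lhs => rw [← hp.map_eq]
    rw [hΦ.eLpNorm_map_measure, hcomp]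
  have hm : AEStronglyMeasurable f volume := by
    rw [← hp.map_eq, hΦ.aestronglyMeasurable_map_iff, hcomp]
    exact h1.1
  have hf1 : MemLp f 1 volume := ⟨hm, by rw [hnorm]; exact h1.2⟩
  refine ⟨f, hf1, ⟨hm, by rw [hnorm]; exact ht.2⟩, ?_, hnorm⟩
  refine VectorMeasure.ext fun s hs => ?_
  rw [push, VectorMeasure.map_apply _ hΦ.measurable hs,
    withDensityᵥ_apply (memLp_one_iff_integrable.1 h1) (hΦ.measurable hs),
    withDensityᵥ_apply (memLp_one_iff_integrable.1 hf1) hs, ← hcomp]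
  exact hp.setIntegral_preimage_emb hΦ f s

theorem IsSolution.exists_density {k : Plane → Plane} (hk : SmoothBdd k)
    (hdiv : ∀ x, ptrace (fderiv ℝ k x) = 0) {f₀ : Plane → ℝ} {θ : ℝ → SignedMeasure Plane}
    (h1 : MemLp f₀ 1 volume) (htop : MemLp f₀ ⊤ volume)
    (h : IsSolution k (volume.withDensityᵥ f₀) θ) {t : ℝ} (ht : 0 ≤ t) :
    ∃ f : Plane → ℝ, MemLp f 1 volume ∧ MemLp f ⊤ volume ∧ θ t = volume.withDensityᵥ f ∧
      ∀ p : ℝ≥0∞, eLpNorm f p volume ≤ eLpNorm f₀ p volume := by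
  obtain ⟨u, L, X, hu, hX, hv, -, hpush⟩ := h.exists_flow hk ht
  have hdiv' : ∀ s x, ptrace (fderiv ℝ (u s) x) = 0 := by
    intro s x
    obtain ⟨r, -, hr⟩ := hv s
    rw [hr]
    exact ptrace_fderiv_velocity hk hdiv _ x
  obtain ⟨f, hf1, hft, he, hn⟩ := push_withDensity (hX.measurableEmbedding hu ht)
    (hX.measurePreserving hu hdiv' ht) h1 htop
  exact ⟨f, hf1, hft, (hpush t ⟨ht, le_rfl⟩).trans he, fun p => (hn p).le⟩

end Density

/-! ### Existence by an ordinary differential equation for the displacement -/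

section Existence

variable {k : Plane → Plane}

/-- The velocity at `z` that is induced by the image of `μ` under `id + D`. -/
def inducedVelocity (k : Plane → Plane) (μ : SignedMeasure Plane) (D : Plane → Plane)
    (z : Plane) : Plane :=
  sintegral μ fun y => k (z - (y + D y))

theorem norm_inducedVelocity_sub_le (hk : SmoothBdd k) {K : ℝ}
    (hK : ∀ x, ‖fderiv ℝ k x‖ ≤ K) (μ : SignedMeasure Plane) {D D' : Plane → Plane}
    (hD : Continuous D) (hD' : Continuous D') {a : ℝ} (ha : ∀ y, ‖D y - D' y‖ ≤ a)
    (z z' : Plane) :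
    ‖inducedVelocity k μ D z - inducedVelocity k μ D' z'‖
      ≤ K * (‖z - z'‖ + a) * μ.totalVariation.real univ := by
  obtain ⟨C, hC⟩ := hk.exists_bound
  have hK0 : 0 ≤ K := (norm_nonneg _).trans (hK 0)
  have ha0 : 0 ≤ a := (norm_nonneg _).trans (ha 0)
  have hlip : ∀ x y, ‖k x - k y‖ ≤ K * ‖x - y‖ := fun x y =>
    convex_univ.norm_image_sub_le_of_norm_fderiv_le (𝕜 := ℝ)
      (fun w _ => hk.smooth.differentiable (by simp) w) (fun w _ => hK w) (mem_univ y) (mem_univ x)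
  have hi : ∀ {D : Plane → Plane} (z : Plane), Continuous D →
      Integrable (fun y => k (z - (y + D y))) μ.totalVariation := fun {D} z hD =>
    integrable_of_continuous_bounded
      (hk.smooth.continuous.comp (continuous_const.sub (continuous_id.add hD))) fun y => hC _
  rw [inducedVelocity, inducedVelocity, ← sintegral_sub (hi z hD) (hi z' hD')]
  refine norm_sintegral_le (by positivity) (fun y => (hlip _ _).trans ?_) le_rfl
  gcongr
  calc ‖z - (y + D y) - (z' - (y + D' y))‖ = ‖(z - z') - (D y - D' y)‖ := by congr 1; abel
    _ ≤ _ := (norm_sub_le _ _).trans (add_le_add le_rfl (ha y))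

theorem norm_inducedVelocity_le {K : ℝ} (hK : ∀ x, ‖k x‖ ≤ K) (μ : SignedMeasure Plane)
    (D : Plane → Plane) (z : Plane) :
    ‖inducedVelocity k μ D z‖ ≤ K * μ.totalVariation.real univ :=
  norm_sintegral_le ((norm_nonneg _).trans (hK 0)) (fun _ => hK _) le_rfl

/-- The displacement of the particles solves an ordinary differential equation in the space of
bounded continuous functions. -/
theorem exists_displacement (hk : SmoothBdd k) (μ : SignedMeasure Plane) :
    ∃ D V : ℝ → Plane →ᵇ Plane, D 0 = 0 ∧ Continuous V ∧ (∀ t, HasDerivAt D (V t) t) ∧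
      ∀ t x, V t x = inducedVelocity k μ (D t) (x + D t x) := by
  obtain ⟨K₀, hK₀⟩ := hk.exists_bound
  obtain ⟨K₁, hK₁⟩ := hk.derivative.exists_bound
  set M := μ.totalVariation.real univ with hM
  have hM0 : 0 ≤ M := measureReal_nonneg
  have hK₀0 : 0 ≤ K₀ := (norm_nonneg _).trans (hK₀ 0)
  have hK₁0 : 0 ≤ K₁ := (norm_nonneg _).trans (hK₁ 0)
  have hcont : ∀ D : Plane →ᵇ Plane, Continuous fun x => inducedVelocity k μ D (x + D x) := by
    intro D
    have h1 : Continuous fun z => inducedVelocity k μ D z :=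
      (LipschitzWith.of_dist_le_mul (K := ⟨K₁ * M, by positivity⟩) fun z z' => by
        rw [dist_eq_norm, dist_eq_norm]
        have := norm_inducedVelocity_sub_le hk hK₁ μ D.continuous D.continuous (a := 0)
          (fun y => by simp) z z'
        rw [add_zero] at this
        exact this.trans_eq (mul_right_comm _ _ _)).continuous
    exact h1.comp (continuous_id.add D.continuous)
  let F : (Plane →ᵇ Plane) → (Plane →ᵇ Plane) := fun D =>
    BoundedContinuousFunction.ofNormedAddCommGroup _ (hcont D) (K₀ * M)
      fun x => norm_inducedVelocity_le hK₀ μ _ _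
  have hF : ∀ D x, F D x = inducedVelocity k μ D (x + D x) := fun D x => rfl
  have hFb : ∀ (_ : ℝ) (D : Plane →ᵇ Plane), ‖F D‖ ≤ (⟨K₀ * M, by positivity⟩ : ℝ≥0) :=
    fun _ D => (BoundedContinuousFunction.norm_le (by positivity)).2
      fun x => norm_inducedVelocity_le hK₀ μ _ _
  -- One $K_1M$ comes from the displaced evaluation point, the other from the displaced measure.
  have hFl : LipschitzWith ⟨2 * K₁ * M, by positivity⟩ F := by
    refine LipschitzWith.of_dist_le_mul fun D D' => ?_
    change dist (F D) (F D') ≤ 2 * K₁ * M * dist D D'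
    rw [dist_eq_norm, dist_eq_norm]
    refine (BoundedContinuousFunction.norm_le (by positivity)).2 fun x => ?_
    rw [BoundedContinuousFunction.sub_apply, hF, hF]
    have hDD : ∀ y, ‖D y - D' y‖ ≤ ‖D - D'‖ := fun y =>
      BoundedContinuousFunction.norm_coe_le_norm (D - D') y
    refine (norm_inducedVelocity_sub_le hk hK₁ μ D.continuous D'.continuous hDD _ _).trans ?_
    rw [add_sub_add_left_eq_sub]
    calc K₁ * (‖D x - D' x‖ + ‖D - D'‖) * M ≤ K₁ * (‖D - D'‖ + ‖D - D'‖) * M := by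
          gcongr
          exact hDD x
      _ = _ := by ring
  obtain ⟨D, hD0, hD⟩ := exists_global_integralCurve (v := fun _ => F) hFb (fun _ => hFl)
    (fun _ => continuous_const) 0
  exact ⟨D, fun t => F (D t), hD0, hFl.continuous.comp
    (continuous_iff_continuousAt.2 fun t => (hD t).continuousAt), hD, fun t x => rfl⟩

/-- Exchange of a time integral with an integral against a signed measure. -/
theorem sintegral_intervalIntegral (μ : SignedMeasure Plane) {j : ℝ × Plane → ℝ}
    (hj : Continuous j) {C : ℝ} (hC : ∀ q, ‖j q‖ ≤ C) {t : ℝ} (ht : 0 ≤ t) :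
    Continuous (fun s => sintegral μ fun x => j (s, x)) ∧
      (sintegral μ fun x => ∫ s in (0 : ℝ)..t, j (s, x))
        = ∫ s in (0 : ℝ)..t, sintegral μ fun x => j (s, x) := by
  have hc : ∀ (ν : Measure Plane) [IsFiniteMeasure ν], Continuous fun s => ∫ x, j (s, x) ∂ν :=
    fun ν _ => continuous_of_dominated (bound := fun _ => C)
      (fun s => (hj.comp (Continuous.prodMk_right s)).aestronglyMeasurable)
      (fun s => Eventually.of_forall fun x => hC _) (integrable_const C)
      (Eventually.of_forall fun x => hj.comp (Continuous.prodMk_left x))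
  have hs : ∀ (ν : Measure Plane) [IsFiniteMeasure ν], ∫ x, (∫ s in (0 : ℝ)..t, j (s, x)) ∂ν
      = ∫ s in (0 : ℝ)..t, (∫ x, j (s, x) ∂ν) := by
    intro ν _
    simp only [intervalIntegral.integral_of_le ht]
    have hi : Integrable j ((volume.restrict (Ioc 0 t)).prod ν) :=
      integrable_of_continuous_bounded hj hC
    exact (integral_integral_swap (f := fun s x => j (s, x)) hi).symm
  refine ⟨(hc _).sub (hc _), ?_⟩
  simp only [sintegral]
  rw [hs, hs, intervalIntegral.integral_sub ((hc _).intervalIntegrable _ _)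
    ((hc _).intervalIntegrable _ _)]

/-- The solution is the image of $\theta_0$ under $X_t=\mathrm{id}+D_t$. The velocity that this
image induces at $X_t(x)$ is exactly the speed of the particle, so the weak equation is the chain
rule along trajectories, integrated against $\theta_0$. -/
theorem exists_isSolution (hk : SmoothBdd k) (θ₀ : SignedMeasure Plane) :
    ∃ θ : ℝ → SignedMeasure Plane, IsSolution k θ₀ θ := by
  obtain ⟨K₀, hK₀⟩ := hk.exists_bound
  obtain ⟨K₁, hK₁⟩ := hk.derivative.exists_bound
  obtain ⟨D, V, hD0, hVc, hD, hV⟩ := exists_displacement hk θ₀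
  set M := θ₀.totalVariation.real univ with hM
  have hM0 : 0 ≤ M := measureReal_nonneg
  have hK₁0 : 0 ≤ K₁ := (norm_nonneg _).trans (hK₁ 0)
  have hDc : Continuous D := continuous_iff_continuousAt.2 fun t => (hD t).continuousAt
  let X : ℝ → Plane → Plane := fun t x => x + D t x
  have hX0 : ∀ x, X 0 x = x := fun x => by simp [X, hD0]
  have hXd : ∀ t x, HasDerivAt (fun s => X s x) (V t x) t := fun t x =>
    HasDerivAt.const_add x <| (BoundedContinuousFunction.evalCLM ℝ x :
      (Plane →ᵇ Plane) →L[ℝ] Plane).hasFDerivAt.comp_hasDerivAt t (hD t)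
  have hXc : Continuous fun q : ℝ × Plane => X q.1 q.2 :=
    continuous_snd.add ((hDc.comp continuous_fst).eval continuous_snd)
  have hVc' : Continuous fun q : ℝ × Plane => V q.1 q.2 :=
    (hVc.comp continuous_fst).eval continuous_snd
  have hVb : ∀ t x, ‖V t x‖ ≤ K₀ * M := fun t x => by
    rw [hV]
    exact norm_inducedVelocity_le hK₀ θ₀ _ _
  have hlip : ∀ t, LipschitzWith ⟨K₁ * M, by positivity⟩ (inducedVelocity k θ₀ (D t)) := by
    intro t
    refine LipschitzWith.of_dist_le_mul fun z z' => ?_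
    rw [dist_eq_norm, dist_eq_norm]
    have := norm_inducedVelocity_sub_le hk hK₁ θ₀ (D t).continuous (D t).continuous (a := 0)
      (fun y => by simp) z z'
    rw [add_zero] at this
    exact this.trans_eq (mul_right_comm _ _ _)
  -- With `D` known, all particles solve one ordinary differential equation with a Lipschitz field;
  -- two that meet coincide at time $0$.
  have hinj : ∀ t, Function.Injective (X t) := by
    intro t x y hxy
    have := ODE_solution_unique_univ (v := fun t => inducedVelocity k θ₀ (D t))
      (s := fun _ => univ) (f := fun s => X s x) (g := fun s => X s y) (t₀ := t)
      (fun s => (hlip s).lipschitzOnWith)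
      (fun s => ⟨by have := hXd s x; rwa [hV] at this, trivial⟩)
      (fun s => ⟨by have := hXd s y; rwa [hV] at this, trivial⟩) hxy
    simpa [hX0] using congrFun this 0
  have hemb : ∀ t, MeasurableEmbedding (X t) := fun t =>
    (hXc.comp (Continuous.prodMk_right t)).measurableEmbedding (hinj t)
  have hvel : ∀ t x, velocity k (push (X t) θ₀) (X t x) = V t x := by
    intro t x
    rw [velocity, sintegral_push (hemb t), hV]
    rfl
  have hflux : ∀ (φ : Plane → ℝ) (s : ℝ), (sintegral (push (X s) θ₀) fun x =>
      fderiv ℝ φ x (velocity k (push (X s) θ₀) x))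
        = sintegral θ₀ fun x => fderiv ℝ φ (X s x) (V s x) := by
    intro φ s
    rw [sintegral_push (hemb s)]
    simp only [hvel]
  have hj : ∀ φ : Plane → ℝ, ContDiff ℝ ∞ φ → HasCompactSupport φ →
      (Continuous fun q : ℝ × Plane => fderiv ℝ φ (X q.1 q.2) (V q.1 q.2)) ∧
        ∃ C, ∀ q : ℝ × Plane, ‖fderiv ℝ φ (X q.1 q.2) (V q.1 q.2)‖ ≤ C := by
    intro φ hφ hc
    refine ⟨((hφ.continuous_fderiv (by simp)).comp hXc).clm_apply hVc', ?_⟩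
    obtain ⟨A, hA⟩ := exists_bound_fderiv hφ hc
    exact ⟨A * (K₀ * M), fun q => (ContinuousLinearMap.le_opNorm _ _).trans
      (mul_le_mul (hA _) (hVb _ _) (norm_nonneg _) ((norm_nonneg _).trans (hA 0)))⟩
  refine ⟨fun t => push (X t) θ₀, fun T => ?_, fun φ hφ hc t ht => ?_, fun φ hφ hc t ht => ?_⟩
  · refine ⟨(θ₀.totalVariation univ).toNNReal, fun t _ => ?_⟩
    rw [totalVariation_push_univ (hemb t), ENNReal.coe_toNNReal (measure_ne_top _ _)]
  · obtain ⟨hjc, C, hC⟩ := hj φ hφ hc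
    simp only [hflux]
    exact (sintegral_intervalIntegral θ₀ hjc hC ht).1.intervalIntegrable _ _
  · obtain ⟨hjc, C, hC⟩ := hj φ hφ hc
    obtain ⟨B, hB⟩ := hc.exists_bound_of_continuous hφ.continuous
    have hi : Integrable (fun x => φ (X t x)) θ₀.totalVariation :=
      integrable_of_continuous_bounded
        (hφ.continuous.comp (hXc.comp (Continuous.prodMk_right t))) fun x => hB _
    simp only [hflux]
    rw [← (sintegral_intervalIntegral θ₀ hjc hC ht).2, sintegral_push (hemb t),
      ← sintegral_sub hi (integrable_of_continuous_bounded hφ.continuous hB)]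
    congr 1
    funext x
    have hd : ∀ s, HasDerivAt (fun s => φ (X s x)) (fderiv ℝ φ (X s x) (V s x)) s := fun s =>
      (hφ.differentiable (by simp) _).hasFDerivAt.comp_hasDerivAt s (hXd s x)
    rw [intervalIntegral.integral_eq_sub_of_hasDerivAt (fun s _ => hd s)
      ((hjc.comp (Continuous.prodMk_left x)).intervalIntegrable _ _), hX0]

end Existence

end GSQG

end

/-! ### The theorem -/

theorem corollaryc :
    ∃ C : ℝ≥0 → ℝ → ℝ≥0 → ℝ≥0,
      ∀ (m κ : ℝ) (ρ : GSQG.Plane → ℝ) (ε : ℝ),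
        1 < m → m < 2 → GSQG.IsMollifier ρ → 0 < ε →
        -- existence
        (∀ θ₀ : SignedMeasure GSQG.Plane,
          ∃ θ : ℝ → SignedMeasure GSQG.Plane,
            GSQG.IsSolution (GSQG.regKernel m κ ρ ε) θ₀ θ) ∧
        -- uniqueness
        (∀ (θ₀ : SignedMeasure GSQG.Plane) (θ θ' : ℝ → SignedMeasure GSQG.Plane),
          GSQG.IsSolution (GSQG.regKernel m κ ρ ε) θ₀ θ →
          GSQG.IsSolution (GSQG.regKernel m κ ρ ε) θ₀ θ' →
          ∀ t : ℝ, 0 ≤ t → θ t = θ' t) ∧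
        -- stability
        GSQG.kernelConst (GSQG.regKernel m κ ρ ε) ≠ ⊤ ∧
        (∀ (θ₀₁ θ₀₂ : SignedMeasure GSQG.Plane) (θ₁ θ₂ : ℝ → SignedMeasure GSQG.Plane)
          (M : ℝ≥0) (T : ℝ),
          θ₀₁.toJordanDecomposition.posPart Set.univ
            = θ₀₂.toJordanDecomposition.posPart Set.univ →
          θ₀₁.toJordanDecomposition.negPart Set.univ
            = θ₀₂.toJordanDecomposition.negPart Set.univ →
          θ₀₁.totalVariation Set.univ ≤ M →
          GSQG.IsSolution (GSQG.regKernel m κ ρ ε) θ₀₁ θ₁ →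
          GSQG.IsSolution (GSQG.regKernel m κ ρ ε) θ₀₂ θ₂ →
          0 < T →
          (⨆ t ∈ Set.Icc 0 T, GSQG.signedWass (θ₁ t) (θ₂ t))
            ≤ C (GSQG.kernelConst (GSQG.regKernel m κ ρ ε)).toNNReal T M
              * GSQG.signedWass θ₀₁ θ₀₂) ∧
        -- the bound on the Lebesgue norms
        (∀ (f₀ : GSQG.Plane → ℝ) (θ : ℝ → SignedMeasure GSQG.Plane),
          MemLp f₀ 1 volume → MemLp f₀ ⊤ volume →
          GSQG.IsSolution (GSQG.regKernel m κ ρ ε) (volume.withDensityᵥ f₀) θ →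
          ∀ t : ℝ, 0 ≤ t → ∃ f : GSQG.Plane → ℝ,
            MemLp f 1 volume ∧ MemLp f ⊤ volume ∧ θ t = volume.withDensityᵥ f ∧
            ∀ p : ℝ≥0∞, eLpNorm f p volume ≤ eLpNorm f₀ p volume) := by
  -- The constant is the Grönwall factor $e^{2cMT}$, where `M` bounds the mass of the couplings.
  refine ⟨fun c T M => Real.toNNReal (Real.exp (2 * c * M * T)),
    fun m κ ρ ε hm1 hm hρ hε => ?_⟩
  have hk := GSQG.smoothBdd_regKernel (κ := κ) hm1 hm hρ hε
  refine ⟨GSQG.exists_isSolution hk, fun θ₀ θ θ' h h' t ht => h.unique hk h' ht,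
    GSQG.kernelConst_ne_top hk, fun θ₀₁ θ₀₂ θ₁ θ₂ M T _ _ hM h₁ h₂ _ => ?_,
    fun f₀ θ h1 htop h t ht => h.exists_density hk
      (GSQG.ptrace_fderiv_regKernel hm1 hm hρ hε) h1 htop ht⟩
  exact iSup₂_le fun t ht => GSQG.signedWass_le hk h₁ h₂ M.coe_nonneg
    (hM.trans_eq ENNReal.ofReal_coe_nnreal.symm) ht
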